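/- **Setting.** The Hilbert space of $m$ bosonic modes has the orthonormal Fock basis $|n_1,\dots,n_m\rangle$, $n_j\in\mathbb N_0$. With $a_j,a_j^\dagger$ the ladder operators, let $X_j=(a_j+a_j^\dagger)/\sqrt2$, $P_j=(a_j-a_j^\dagger)/(\sqrt2\,i)$, $N_j=a_j^\dagger a_j$ and $N=\sum_j N_j$. A *gate set* $\mathcal G$ is a finite or countably infinite list of polynomials in $X_1,P_1,\dots,X_k,P_k$ (for some fixed $k$) that are essentially self-adjoint on the finite linear combinations of Fock states (equivalently, on the Schwartz space) and have uniformly computable coefficients. An $m$-mode *circuit* over $\mathcal G$ is a product $C=e^{-it_lH_l}\cdots e^{-it_1H_1}$, where $t_1,\dots,t_l\in\mathbb R$ and each $H_i$ is either a Gaussian Hamiltonian (a self-adjoint polynomial of degree at most $2$ in the quadratures) or a member of $\mathcal G$ applied to some of the $m$ modes; its runtime is $\sum_i|t_i|$. Here $e^{-itH}$ is the unitary group generated by the closure of $H$. A promise problem $A=(A_{\mathrm{yes}},A_{\mathrm{no}})$ over $\{0,1\}^*$ is in $\mathsf{CVBQP}[\mathcal G]$ if there are circuits $(C_x)_{x\in\{0,1\}^*}$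 over $\mathcal G$ and integers $0<a_x<b_x\le\mathrm{poly}(|x|)$ such that: the runtime of $C_x$ is at most $\mathrm{poly}(|x|)$; the family is polynomial-time uniform, i.e. a Turing machine on input $(x,1^r)$ prints, in time $\mathrm{poly}(|x|+r)$, the numbers $a_x,b_x$ and a description of $C_x$ in which the real parameters (the times $t_i$ and the coefficients of the Gaussian Hamiltonians) are rounded to precision $2^{-r}$; and, measuring the photon number of the first mode of $C_x|0,\dots,0\rangle$, $$x\in A_{\mathrm{yes}}\Rightarrow\Pr[N_1\in[a_x,b_x]]\ge\tfrac23,\qquad x\in A_{\mathrm{no}}\Rightarrow\Pr[N_1\le a_x-1]\ge\tfrac23 .$$ The class $\mathsf{CVBQP}_{\mathrm{phys}}[\mathcal G]$ is defined in the same way, except that each $C_x$ is required to be *physical*: for every $d\in\mathbb N$ the moment $\langle N^d\rangle$ is bounded, uniformly over all states that occur during the computation of $C_x$ from the vacuum (including the intermediate times of each gate). No knowledge of, or control over, these bounds is assumed. **Theorem.** For every gate set $\mathcal G$, $\mathsf{CVBQP}_{\mathrm{phys}}[\mathcal G]\subseteq\mathsf R$. That is, for every promise problem $A\in\mathsf{CVBQP}_{\mathrm{phys}}[\mathcal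 G]$ there is a recursive language $L$ with $A_{\mathrm{yes}}\subseteq L$ and $A_{\mathrm{no}}\cap L=\emptyset$; in particular, every language in $\mathsf{CVBQP}_{\mathrm{phys}}[\mathcal G]$ is recursive. -/

import Mathlib

noncomputable section

namespace Bosonic

/-! ### Fock space and the ladder, position and momentum operators -/

/-- The Hilbert space of `m` bosonic modes, in the Fock basis: square-summable families of
amplitudes indexed by the photon numbers `n = (n₁, …, nₘ)`. -/
abbrev Fock (m : ℕ) : Type := lp (fun _ : Fin m → ℕ => ℂ) 2

/-- Finite superpositions of Fock states, the common domain of all polynomials in the position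
and momentum operators. -/
abbrev FiniteState (m : ℕ) : Type := (Fin m → ℕ) →₀ ℂ

/-- The Fock state `|n₁, …, nₘ⟩`. -/
def ket {m : ℕ} (n : Fin m → ℕ) : Fock m := lp.single 2 n (1 : ℂ)

/-- The vacuum `|0, …, 0⟩`. -/
def vacuum (m : ℕ) : Fock m := ket 0

/-- The inclusion of the finite superpositions into the Hilbert space. -/
def toFock (m : ℕ) : FiniteState m →ₗ[ℂ] Fock m := Finsupp.linearCombination ℂ ket

theorem toFock_apply {m : ℕ} (f : FiniteState m) (n : Fin m → ℕ) : toFock m f n = f n := by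
  induction f using Finsupp.induction_linear with
  | zero => simp
  | add f g hf hg => simp [hf, hg]
  | single k c =>
    by_cases h : n = k
    · subst h
      simp [toFock, ket]
    · simp [toFock, ket, lp.single_apply, h]

theorem toFock_injective (m : ℕ) : Function.Injective (toFock m) := by
  intro f g h
  ext n
  rw [← toFock_apply f n, ← toFock_apply g n, h]

/-- `a_j |n⟩ = √n_j |n - e_j⟩`. -/
def annihilation {m : ℕ} (j : Fin m) : Module.End ℂ (FiniteState m) :=
  Finsupp.linearCombination ℂ fun n =>
    Finsupp.single (Function.update n j (n j - 1)) ((√(n j : ℝ) : ℝ) : ℂ)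

/-- `a_j† |n⟩ = √(n_j + 1) |n + e_j⟩`. -/
def creation {m : ℕ} (j : Fin m) : Module.End ℂ (FiniteState m) :=
  Finsupp.linearCombination ℂ fun n =>
    Finsupp.single (Function.update n j (n j + 1)) ((√(n j + 1 : ℝ) : ℝ) : ℂ)

/-- `X_j = (a_j + a_j†) / √2`. -/
def position {m : ℕ} (j : Fin m) : Module.End ℂ (FiniteState m) :=
  (1 / ((√2 : ℝ) : ℂ)) • (annihilation j + creation j)

/-- `P_j = (a_j - a_j†) / (√2 i)`. -/
def momentum {m : ℕ} (j : Fin m) : Module.End ℂ (FiniteState m) :=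
  (1 / (((√2 : ℝ) : ℂ) * Complex.I)) • (annihilation j - creation j)

/-- The quadratures `(X₁, …, Xₘ, P₁, …, Pₘ)`. -/
def quadrature {m : ℕ} : Fin (m + m) → Module.End ℂ (FiniteState m) :=
  Fin.append position momentum

/-! ### Hamiltonians -/

/-- The operator of a polynomial `p ∈ ℂ[X₁, P₁, …, X_k, P_k]` with the `k` modes renamed to modes
among `m` by `σ`. The variable `Sum.inl j` is `X_j` and `Sum.inr j` is `P_j`. In every monomial the
positions stand to the left of the momenta; by the commutation relations each polynomial in the
quadratures is in exactly one way of this form. -/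
def polynomialOp {k m : ℕ} (σ : Fin k → Fin m) (p : MvPolynomial (Fin k ⊕ Fin k) ℂ) :
    Module.End ℂ (FiniteState m) :=
  ∑ s ∈ p.support, p.coeff s •
    ((List.ofFn fun j => position (σ j) ^ s (Sum.inl j)).prod *
      (List.ofFn fun j => momentum (σ j) ^ s (Sum.inr j)).prod)

/-- The quadratic Hamiltonian `∑ A_{uv} R_u R_v + ∑ b_u R_u + c` in the quadratures `R_u`. -/
def quadraticOp {m : ℕ} (A : Matrix (Fin (m + m)) (Fin (m + m)) ℝ) (b : Fin (m + m) → ℝ) (c : ℝ) :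
    Module.End ℂ (FiniteState m) :=
  (∑ u, ∑ v, (A u v : ℂ) • (quadrature u * quadrature v)) + (∑ u, (b u : ℂ) • quadrature u) +
    (c : ℂ) • 1

/-- A linear operator on the finite superpositions, as a densely defined unbounded operator on
the Hilbert space. -/
def unboundedOp {m : ℕ} (T : Module.End ℂ (FiniteState m)) : Fock m →ₗ.[ℂ] Fock m where
  domain := LinearMap.range (toFock m)
  toFun := (toFock m ∘ₗ T) ∘ₗ
    (LinearEquiv.ofInjective (toFock m) (toFock_injective m)).symm.toLinearMap

/-- Essential self-adjointness: the closure is self-adjoint. -/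
def IsEssentiallySelfAdjoint {m : ℕ} (H : Fock m →ₗ.[ℂ] Fock m) : Prop :=
  IsSelfAdjoint H.closure

/-- `U t = e^{-itH}`: `U` is the strongly continuous one-parameter unitary group whose
generator is the closure of `H`. That is, `U t φ` is differentiable at `t = 0` with derivative `χ`
if and only if `φ` is in the domain of the closure `H̄` and `χ = -i H̄ φ`. (By Stone's theorem there
is exactly one such `U` if `H` is essentially self-adjoint.) -/
structure IsPropagator {m : ℕ} (H : Fock m →ₗ.[ℂ] Fock m) (U : ℝ → (Fock m ≃ₗᵢ[ℂ] Fock m)) :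
    Prop where
  map_zero : ∀ φ, U 0 φ = φ
  map_add : ∀ s t φ, U (s + t) φ = U s (U t φ)
  continuous : ∀ φ, Continuous fun t => U t φ
  generator : ∀ φ χ, HasDerivAt (fun t => U t φ) χ 0 ↔ (φ, Complex.I • χ) ∈ H.closure.graph

/-! ### Gate sets and circuits -/

/-- `z / 2 ^ r` is an approximation of `y` to within `2 ^ (-r)`. -/
def IsRounding (r : ℕ) (z : ℤ) (y : ℝ) : Prop := |y - (z : ℝ) / 2 ^ r| ≤ 1 / 2 ^ r

/-- The monomial whose exponents, in the order `X₁, …, X_k, P₁, …, P_k`, are listed in `e`. -/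
def monomialOfList {k : ℕ} (e : List ℕ) : (Fin k ⊕ Fin k) →₀ ℕ :=
  Finsupp.equivFunOnFinite.symm
    (Sum.elim (fun j => e.getD j 0) (fun j => e.getD (k + j) 0))

/-- The list `l` of triples (monomial, real part, imaginary part) contains all monomials of `p`
with a non-zero coefficient, and it gives all coefficients that it lists up to `2 ^ (-r)`. -/
def ApproximatesPolynomial {k : ℕ} (r : ℕ) (l : List (List ℕ × ℤ × ℤ))
    (p : MvPolynomial (Fin k ⊕ Fin k) ℂ) : Prop :=
  (∀ s ∈ p.support, ∃ e ∈ l, monomialOfList e.1 = s) ∧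
    ∀ e ∈ l, IsRounding r e.2.1 (p.coeff (monomialOfList e.1)).re ∧
      IsRounding r e.2.2 (p.coeff (monomialOfList e.1)).im

/-- A gate set: Hamiltonians `H₀, H₁, …` (repetitions are allowed, so this includes the finite
gate sets) that are essentially self-adjoint polynomials in the quadratures of `k` modes, with
computable coefficients. -/
structure GateSet where
  /-- the number `k` of modes on which the Hamiltonians of the gate set act -/
  modes : ℕ
  /-- the Hamiltonians -/
  ham : ℕ → MvPolynomial (Fin modes ⊕ Fin modes) ℂ
  essentiallySelfAdjoint : ∀ i, IsEssentiallySelfAdjoint (unboundedOp (polynomialOp id (ham i)))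
  computable : ∃ F : ℕ → ℕ → List (List ℕ × ℤ × ℤ), Computable₂ F ∧
    ∀ i r, ApproximatesPolynomial r (F i r) (ham i)

/-- A gate `e^{-itH}` on `m` modes: `H` is either the `i`-th Hamiltonian of a gate set on `k` modes,
applied to the modes `σ 0, …, σ (k-1)`, or a Gaussian (that is, quadratic) Hamiltonian. -/
inductive Gate (k m : ℕ) : Type
  | fromSet (i : ℕ) (σ : Fin k ↪ Fin m) (t : ℝ)
  | gaussian (A : Matrix (Fin (m + m)) (Fin (m + m)) ℝ) (hA : A.IsSymm) (b : Fin (m + m) → ℝ)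
      (c : ℝ) (t : ℝ)

/-- The evolution time `t` of a gate. -/
def Gate.time {k m : ℕ} : Gate k m → ℝ
  | .fromSet _ _ t => t
  | .gaussian _ _ _ _ t => t

/-- The Hamiltonian `H` of a gate. -/
def Gate.hamiltonian (𝒢 : GateSet) {m : ℕ} : Gate 𝒢.modes m → Fock m →ₗ.[ℂ] Fock m
  | .fromSet i σ _ => unboundedOp (polynomialOp σ (𝒢.ham i))
  | .gaussian A _ b c _ => unboundedOp (quadraticOp A b c)

/-- A circuit `e^{-it_l H_l} ⋯ e^{-it_1 H_1}` on finitely many modes; the list starts with the gate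
that is applied first. -/
structure Circuit (k : ℕ) where
  modes : ℕ
  modes_pos : 0 < modes
  gates : List (Gate k modes)

/-- The total runtime of a circuit. -/
def Circuit.runtime {k : ℕ} (C : Circuit k) : ℝ := (C.gates.map fun g => |g.time|).sum

/-- A choice of a one-parameter family of unitaries for each gate on `m` modes. -/
abbrev Unitaries (k m : ℕ) : Type := Gate k m → ℝ → (Fock m ≃ₗᵢ[ℂ] Fock m)

/-- `U g t = e^{-itH}` for each gate `g` of the circuit, `H` being its Hamiltonian. -/
def Circuit.IsImplementedBy {𝒢 : GateSet} (C : Circuit 𝒢.modes) (U : Unitaries 𝒢.modes C.modes) :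
    Prop :=
  ∀ g ∈ C.gates, IsPropagator (g.hamiltonian 𝒢) (U g)

/-- The state after all gates of the list. -/
def finalState {k m : ℕ} (U : Unitaries k m) : List (Gate k m) → Fock m → Fock m
  | [], ψ => ψ
  | g :: l, ψ => finalState U l (U g g.time ψ)

/-- All states that occur during the computation, also in the course of a gate. -/
def intermediateStates {k m : ℕ} (U : Unitaries k m) : List (Gate k m) → Fock m → Set (Fock m)
  | [], ψ => {ψ}
  | g :: l, ψ =>
    (fun s => U g s ψ) '' Set.uIcc 0 g.time ∪ intermediateStates U l (U g g.time ψ)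

/-- The output state `C |0, …, 0⟩`. -/
def Circuit.output {k : ℕ} (C : Circuit k) (U : Unitaries k C.modes) : Fock C.modes :=
  finalState U C.gates (vacuum C.modes)

/-- The probability that the number of photons measured in the first mode of the output state
lies in `S`. -/
def Circuit.prob {k : ℕ} (C : Circuit k) (U : Unitaries k C.modes) (S : Set ℕ) : ℝ :=
  ∑' n : {n : Fin C.modes → ℕ // n ⟨0, C.modes_pos⟩ ∈ S}, ‖C.output U n.1‖ ^ 2

/-- The moment `⟨N ^ k⟩ ∈ [0, ∞]` of the total photon number `N = N₁ + ⋯ + Nₘ`. -/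
def photonMoment {m : ℕ} (k : ℕ) (ψ : Fock m) : ENNReal :=
  ∑' n : Fin m → ℕ, (((∑ j, n j : ℕ) : ENNReal)) ^ k * ENNReal.ofReal (‖ψ n‖ ^ 2)

/-- The computation is physical: every moment of the photon number is bounded uniformly over the
course of the computation. -/
def Circuit.IsPhysical {k : ℕ} (C : Circuit k) (U : Unitaries k C.modes) : Prop :=
  ∀ d : ℕ, ∃ M : NNReal, ∀ ψ ∈ intermediateStates U C.gates (vacuum C.modes),
    photonMoment d ψ ≤ M

/-! ### Descriptions of circuits and uniform families -/

/-- The alphabet of descriptions: two bits, a comma `some none` and a semicolon `none`. -/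
abbrev Token : Type := Option (Option Bool)

/-- Reads a string as a table: every entry of a row is a bit string that is closed by a comma, and
every row is closed by a semicolon. -/
def readTable (w : List Token) : List (List (List Bool)) :=
  w.foldr (fun c T => match c, T with
    | none, T => [] :: T
    | some none, row :: T => ([] :: row) :: T
    | some (some b), (entry :: row) :: T => ((b :: entry) :: row) :: T
    | _, T => T) []

/-- Reads a bit string as an integer: a sign bit, then the binary digits of the absolute value,
the least significant one first. -/
def readInt : List Bool → ℤ
  | [] => 0
  | s :: l => (if s then -1 else 1) * ((l.foldr Nat.bit 0 : ℕ) : ℤ)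

/-- The discrete data of a gate. -/
def Gate.tag {k m : ℕ} : Gate k m → List ℤ
  | .fromSet i σ _ => 0 :: (i : ℤ) :: List.ofFn fun j => ((σ j : ℕ) : ℤ)
  | .gaussian _ _ _ _ _ => [1]

/-- The real parameters of a gate. -/
def Gate.params {k m : ℕ} : Gate k m → List ℝ
  | .fromSet _ _ t => [t]
  | .gaussian A _ b c t => t :: c :: (List.ofFn b ++ (List.ofFn fun u => List.ofFn (A u)).flatten)

/-- A row describes a gate with precision `r`: it consists of the discrete data, followed by the
real parameters, rounded to multiples of `2 ^ (-r)` with error at most `2 ^ (-r)`. -/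
def Gate.IsDescribedBy {k m : ℕ} (g : Gate k m) (r : ℕ) (row : List (List Bool)) : Prop :=
  ∃ zs : List ℤ, row.map readInt = g.tag ++ zs ∧ List.Forall₂ (IsRounding r) zs g.params

/-- A string describes a circuit `C` and integers `a`, `b` with precision `r`: the first row holds
the number of modes, `a` and `b`, and the other rows describe the gates one by one. -/
def Circuit.IsDescribedBy {k : ℕ} (C : Circuit k) (a b r : ℕ) (w : List Token) : Prop :=
  ∃ head rows, readTable w = head :: rows ∧ head.map readInt = [(C.modes : ℤ), (a : ℤ), (b : ℤ)] ∧
    List.Forall₂ (fun g row => g.IsDescribedBy r row) C.gates rows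

/-- The input `(x, 1 ^ r)`, as a string. -/
def inputString (p : List Bool × ℕ) : List (Option Bool) :=
  p.1.map some ++ List.replicate p.2 none

/-- The circuits `C x` and the integers `a x`, `b x` are polynomial-time uniform: a Turing machine
prints, on input `x` and `1 ^ r`, in time polynomial in `|x| + r`, a description of them with
precision `r`. -/
def IsPolyTimeUniform {k : ℕ} (C : List Bool → Circuit k) (a b : List Bool → ℕ) : Prop :=
  ∃ f : List Bool × ℕ → List Token,
    Nonempty (Turing.TM2ComputableInPolyTime inputString (id : List Token → List Token) f) ∧
      ∀ x r, (C x).IsDescribedBy (a x) (b x) r (f (x, r))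

/-! ### Complexity classes -/

/-- A promise problem over the binary strings. -/
structure PromiseProblem where
  yes : Set (List Bool)
  no : Set (List Bool)
  disjoint : Disjoint yes no

/-- A language, as the promise problem without a promise. -/
def PromiseProblem.ofLanguage (L : Set (List Bool)) : PromiseProblem where
  yes := L
  no := Lᶜ
  disjoint := disjoint_compl_right

/-- The circuits `C x`, run by means of the unitaries `U x`, and the bounds `a x`, `b x` are a `CVBQP`
computation that solves the promise problem `A`. -/
structure Solves (𝒢 : GateSet) (A : PromiseProblem) (C : List Bool → Circuit 𝒢.modes)
    (U : ∀ x, Unitaries 𝒢.modes (C x).modes) (a b : List Bool → ℕ) : Prop where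
  uniform : IsPolyTimeUniform C a b
  implemented : ∀ x, (C x).IsImplementedBy (U x)
  runtime_le : ∃ q : Polynomial ℕ, ∀ x, (C x).runtime ≤ (q.eval x.length : ℕ)
  pos : ∀ x, 0 < a x
  lt : ∀ x, a x < b x
  bound_le : ∃ q : Polynomial ℕ, ∀ x, b x ≤ q.eval x.length
  complete : ∀ x ∈ A.yes, 2 / 3 ≤ (C x).prob (U x) (Set.Icc (a x) (b x))
  sound : ∀ x ∈ A.no, 2 / 3 ≤ (C x).prob (U x) (Set.Iic (a x - 1))

/-- The class `CVBQP[𝒢]`. -/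
def CVBQP (𝒢 : GateSet) : Set PromiseProblem :=
  {A | ∃ C U a b, Solves 𝒢 A C U a b}

/-- The class `CVBQP_phys[𝒢]`: `CVBQP[𝒢]` with physical computations only. -/
def CVBQPphys (𝒢 : GateSet) : Set PromiseProblem :=
  {A | ∃ C U a b, Solves 𝒢 A C U a b ∧ ∀ x, (C x).IsPhysical (U x)}

/-- The recursive languages. -/
def R : Set (Set (List Bool)) := {L | ComputablePred fun x => x ∈ L}

/-- The promise problems that are decided by a recursive language. -/
def PromiseR : Set PromiseProblem := {A | ∃ L ∈ R, A.yes ⊆ L ∧ Disjoint A.no L}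

end Bosonic

end

/-!
The output of a circuit can be approximated, with a guaranteed error, by a search through finite
certificates, and the gates do not have to be simulated step by step with a priori truncation
bounds. That is why no bound on the photon numbers has to be known.

A certificate for a gate `e^{-itH}` that is applied to a finite superposition `c` of Fock states is
a polygon `c = c₀, c₁, …, c_K` of finite superpositions, with coefficients in `ℤ[i, 1/2]` with
respect to suitably rescaled Fock states. It is tested whether the linear interpolation almost
solves the Schrödinger equation, that is, whether `K (c_{j+1} - c_j) + i t H x` is small for
`x = c_j` and for `x = c_{j+1}`.

* Soundness: the mean value inequality, applied to `s ↦ U (t - s) x(s)` for the interpolation `x`,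
  shows that small defects imply that `c_K` is close to `U t c`
  (`IsPropagator.norm_apply_sub_le_of_isChain`). As `U` is unitary, the errors of the gates add up
  (`circuitTest_sound`).
* Completeness: the finite superpositions are a core of the generator, since the generator is the
  closure of `H` on them. Thus the points of the exact orbit at the multiples of `t / K` can be
  approximated in the graph norm, and for large `K` the approximations form a polygon with
  arbitrarily small defects (`IsPropagator.exists_isChain`). All tests succeed as soon as the
  parameters of the circuit are known with a sufficient precision (`circuitTest_complete`).

In the rescaled Fock basis the quadratures have matrix elements in `ℤ[i, 1/2]`, so the squared norms
that occur in the tests are computed exactly (`norm_sq_codeState`), and the tests are primitive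
recursive (`primrec_verify`). A polynomial-time Turing machine computes a primitive recursive
function (`Turing.TM2ComputableInPolyTime.primrec`), and so the descriptions of the circuits are
computable as well. The first certificate that is found determines the output state up to an error
`1/16`, which is enough to tell the two cases of the promise problem apart
(`decision_of_two_thirds_le`): the events `N₁ ∈ [a, b]` and `N₁ ≤ a - 1` are disjoint, hence the
probability of the former is at least `2/3` in one case and at most `1/3` in the other.
-/

/-! ### Primitive recursive functions -/

attribute [fun_prop] Primrec PrimrecPred

namespace Primrec

variable {α β γ σ : Type*} [Primcodable α] [Primcodable β] [Primcodable γ] [Primcodable σ]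

attribute [fun_prop] Primrec.id Primrec.const Primrec.comp

@[fun_prop] theorem fun_fst {f : α → β × γ} (hf : Primrec f) : Primrec fun a => (f a).1 :=
  Primrec.fst.comp hf

@[fun_prop] theorem fun_snd {f : α → β × γ} (hf : Primrec f) : Primrec fun a => (f a).2 :=
  Primrec.snd.comp hf

@[fun_prop] theorem fun_pair {f : α → β} {g : α → γ} (hf : Primrec f) (hg : Primrec g) :
    Primrec fun a => (f a, g a) :=
  Primrec.pair hf hg

@[fun_prop] theorem fun_add {f g : α → ℕ} (hf : Primrec f) (hg : Primrec g) :
    Primrec fun a => f a + g a :=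
  Primrec.nat_add.comp hf hg

@[fun_prop] theorem fun_sub {f g : α → ℕ} (hf : Primrec f) (hg : Primrec g) :
    Primrec fun a => f a - g a :=
  Primrec.nat_sub.comp hf hg

@[fun_prop] theorem fun_mul {f g : α → ℕ} (hf : Primrec f) (hg : Primrec g) :
    Primrec fun a => f a * g a :=
  Primrec.nat_mul.comp hf hg

@[fun_prop] theorem fun_div {f g : α → ℕ} (hf : Primrec f) (hg : Primrec g) :
    Primrec fun a => f a / g a :=
  Primrec.nat_div.comp hf hg

@[fun_prop] theorem fun_mod {f g : α → ℕ} (hf : Primrec f) (hg : Primrec g) :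
    Primrec fun a => f a % g a :=
  Primrec.nat_mod.comp hf hg

@[fun_prop] theorem fun_pow {f g : α → ℕ} (hf : Primrec f) (hg : Primrec g) :
    Primrec fun a => f a ^ g a :=
  (Primrec₂.unpaired'.1 Nat.Primrec.pow).comp hf hg

@[fun_prop] theorem fun_factorial {f : α → ℕ} (hf : Primrec f) :
    Primrec fun a => (f a).factorial := by
  have h : Primrec₂ fun (_ : α) (p : ℕ × ℕ) => (p.1 + 1) * p.2 := by
    unfold Primrec₂; fun_prop
  refine (Primrec.nat_rec' hf (Primrec.const 1) h).of_eq fun a => ?_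
  induction f a with
  | zero => rfl
  | succ n ih => simp only [Nat.factorial_succ, ← ih]

@[fun_prop] theorem fun_bit {f : α → Bool} {g : α → ℕ} (hf : Primrec f) (hg : Primrec g) :
    Primrec fun a => Nat.bit (f a) (g a) := by
  refine (Primrec.cond hf (Primrec.nat_double_succ.comp hg)
    (Primrec.nat_double.comp hg)).of_eq fun a => ?_
  cases f a <;> rfl

@[fun_prop] theorem fun_ite {p : α → Prop} [DecidablePred p] {f g : α → σ} (hp : PrimrecPred p)
    (hf : Primrec f) (hg : Primrec g) : Primrec fun a => if p a then f a else g a :=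
  Primrec.ite hp hf hg

@[fun_prop] theorem fun_decide {p : α → Prop} [DecidablePred p] (hp : PrimrecPred p) :
    Primrec fun a => decide (p a) :=
  hp.decide

@[fun_prop] theorem fun_and {f g : α → Bool} (hf : Primrec f) (hg : Primrec g) :
    Primrec fun a => f a && g a :=
  Primrec.and.comp hf hg

@[fun_prop] theorem fun_cons {f : α → β} {g : α → List β} (hf : Primrec f) (hg : Primrec g) :
    Primrec fun a => f a :: g a :=
  Primrec.list_cons.comp hf hg

@[fun_prop] theorem fun_append {f g : α → List β} (hf : Primrec f) (hg : Primrec g) :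
    Primrec fun a => f a ++ g a :=
  Primrec.list_append.comp hf hg

@[fun_prop] theorem fun_map {f : α → List β} {g : α → β → σ} (hf : Primrec f)
    (hg : Primrec fun p : α × β => g p.1 p.2) : Primrec fun a => (f a).map (g a) :=
  Primrec.list_map hf hg

@[fun_prop] theorem fun_flatMap {f : α → List β} {g : α → β → List σ} (hf : Primrec f)
    (hg : Primrec fun p : α × β => g p.1 p.2) : Primrec fun a => (f a).flatMap (g a) :=
  Primrec.list_flatMap hf hg

@[fun_prop] theorem fun_foldr {f : α → List β} {g : α → σ} {h : α → β → σ → σ} (hf : Primrec f)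
    (hg : Primrec g) (hh : Primrec fun p : α × β × σ => h p.1 p.2.1 p.2.2) :
    Primrec fun a => (f a).foldr (h a) (g a) :=
  Primrec.list_foldr hf hg (h := fun a p => h a p.1 p.2) hh

@[fun_prop] theorem fun_foldl {f : α → List β} {g : α → σ} {h : α → σ → β → σ} (hf : Primrec f)
    (hg : Primrec g) (hh : Primrec fun p : α × σ × β => h p.1 p.2.1 p.2.2) :
    Primrec fun a => (f a).foldl (h a) (g a) :=
  Primrec.list_foldl hf hg (h := fun a p => h a p.1 p.2) hh

@[fun_prop] theorem fun_sum {f : α → List ℕ} (hf : Primrec f) : Primrec fun a => (f a).sum := by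
  simp only [List.sum_eq_foldr]
  fun_prop

@[fun_prop] theorem fun_prod {f : α → List ℕ} (hf : Primrec f) :
    Primrec fun a => (f a).prod := by
  simp only [List.prod_eq_foldr]
  fun_prop

@[fun_prop] theorem fun_length {f : α → List β} (hf : Primrec f) :
    Primrec fun a => (f a).length :=
  Primrec.list_length.comp hf

@[fun_prop] theorem fun_range {f : α → ℕ} (hf : Primrec f) : Primrec fun a => List.range (f a) :=
  Primrec.list_range.comp hf

@[fun_prop] theorem fun_tail {f : α → List β} (hf : Primrec f) : Primrec fun a => (f a).tail :=
  Primrec.list_tail.comp hf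

@[fun_prop] theorem fun_getD {f : α → List β} {g : α → ℕ} (d : β) (hf : Primrec f)
    (hg : Primrec g) : Primrec fun a => (f a).getD (g a) d :=
  (Primrec.list_getD d).comp hf hg

@[fun_prop] theorem fun_replicate {f : α → ℕ} {g : α → β} (hf : Primrec f) (hg : Primrec g) :
    Primrec fun a => List.replicate (f a) (g a) := by
  have h : Primrec fun a => (List.range (f a)).map fun _ => g a := by fun_prop
  exact h.of_eq fun a => by simp [List.map_const']

@[fun_prop] theorem fun_filter {f : α → List β} {p : α → β → Prop} [∀ a, DecidablePred (p a)]
    (hf : Primrec f) (hp : PrimrecPred fun q : α × β => p q.1 q.2) :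
    Primrec fun a => (f a).filter fun b => p a b := by
  have h : Primrec fun a => (f a).flatMap fun b => if p a b then [b] else [] := by fun_prop
  refine h.of_eq fun a => ?_
  induction f a with
  | nil => rfl
  | cons b l ih => by_cases hb : p a b <;> simp_all

theorem polynomial_eval (q : Polynomial ℕ) : Primrec fun n : ℕ => q.eval n := by
  induction q using Polynomial.induction_on' with
  | add p q hp hq => simpa using fun_add hp hq
  | monomial k c => simpa using (by fun_prop : Primrec fun n : ℕ => c * n ^ k)

/-- The sign and the absolute value of an integer, the sign as an exponent of `i`. -/
theorem int_sign_natAbs : Primrec fun z : ℤ => ((if z < 0 then 2 else 0 : ℕ), z.natAbs) := by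
  -- a natural number `n` is encoded as `2 n`, and `-(n + 1)` is encoded as `2 n + 1`
  have h : Primrec fun z : ℤ => if Encodable.encode z % 2 = 0 then (0, Encodable.encode z / 2)
      else (2, Encodable.encode z / 2 + 1) := by
    refine Primrec.ite (Primrec.eq.comp (fun_mod Primrec.encode (Primrec.const 2))
      (Primrec.const 0)) ?_ ?_
    · exact fun_pair (Primrec.const 0) (fun_div Primrec.encode (Primrec.const 2))
    · exact fun_pair (Primrec.const 2) (fun_add (fun_div Primrec.encode (Primrec.const 2))
        (Primrec.const 1))
  refine h.of_eq fun z => ?_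
  cases z with
  | ofNat n =>
    have : Encodable.encode (n : ℤ) = 2 * n := rfl
    simp [this]
  | negSucc n =>
    have h1 : Encodable.encode (Int.negSucc n) = 2 * n + 1 := rfl
    have h2 : (2 * n + 1) / 2 = n := by omega
    simp [h1, h2, Int.negSucc_lt_zero]

end Primrec

namespace PrimrecPred

variable {α β : Type*} [Primcodable α] [Primcodable β]

attribute [fun_prop] PrimrecPred.comp

@[fun_prop] theorem fun_eq {f g : α → β} (hf : Primrec f) (hg : Primrec g) :
    PrimrecPred fun a => f a = g a :=
  Primrec.eq.comp hf hg

@[fun_prop] theorem fun_le {f g : α → ℕ} (hf : Primrec f) (hg : Primrec g) :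
    PrimrecPred fun a => f a ≤ g a :=
  Primrec.nat_le.comp hf hg

@[fun_prop] theorem fun_lt {f g : α → ℕ} (hf : Primrec f) (hg : Primrec g) :
    PrimrecPred fun a => f a < g a :=
  Primrec.nat_lt.comp hf hg

@[fun_prop] theorem fun_and {p q : α → Prop} (hp : PrimrecPred p) (hq : PrimrecPred q) :
    PrimrecPred fun a => p a ∧ q a :=
  PrimrecPred.and hp hq

@[fun_prop] theorem fun_not {p : α → Prop} (hp : PrimrecPred p) : PrimrecPred fun a => ¬p a :=
  PrimrecPred.not hp

end PrimrecPred

/-! ### Turing machines compute primitive recursive functions -/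

namespace Turing.TM2

variable {K : Type} {Γ : K → Type} {Λ σ : Type}

/-- The symbols that a statement may push, each together with its stack. -/
def Stmt.pushed : Stmt Γ Λ σ → Set (Σ k, Γ k)
  | .push k f q => Set.range (fun v => ⟨k, f v⟩) ∪ q.pushed
  | .peek _ _ q => q.pushed
  | .pop _ _ q => q.pushed
  | .load _ q => q.pushed
  | .branch _ q₁ q₂ => q₁.pushed ∪ q₂.pushed
  | .goto _ => ∅
  | .halt => ∅

theorem Stmt.finite_pushed [Finite σ] (q : Stmt Γ Λ σ) : q.pushed.Finite := by
  induction q with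
  | push k f q ih => exact (Set.finite_range _).union ih
  | peek _ _ _ ih => exact ih
  | pop _ _ _ ih => exact ih
  | load _ _ ih => exact ih
  | branch _ _ _ ih₁ ih₂ => exact ih₁.union ih₂
  | goto => exact Set.finite_empty
  | halt => exact Set.finite_empty

/-- All symbols on the stacks belong to `A`. -/
def StacksIn (A : Set (Σ k, Γ k)) (S : ∀ k, List (Γ k)) : Prop :=
  ∀ k, ∀ x ∈ S k, (⟨k, x⟩ : Σ k, Γ k) ∈ A

theorem StacksIn.update [DecidableEq K] {A : Set (Σ k, Γ k)} {S : ∀ k, List (Γ k)}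
    (hS : StacksIn A S) {k : K} {l : List (Γ k)} (hl : ∀ x ∈ l, (⟨k, x⟩ : Σ k, Γ k) ∈ A) :
    StacksIn A (Function.update S k l) := by
  intro k' x hx
  by_cases h : k' = k
  · subst h
    rw [Function.update_self] at hx
    exact hl x hx
  · rw [Function.update_of_ne h] at hx
    exact hS k' x hx

/-- An encoding of configurations by elements of primitive recursively coded types: the labels,
the internal states and the stacks are numbered, and so are the symbols. -/
structure Coding (Γ : K → Type) (Λ σ : Type) where
  numLabels : ℕ
  numStates : ℕ
  numStacks : ℕ
  label : Λ ≃ Fin numLabels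
  state : σ ≃ Fin numStates
  stack : K ≃ Fin numStacks
  numSymbols : ℕ
  symbol : (Σ k, Γ k) → Fin numSymbols

namespace Coding

variable (e : Coding Γ Λ σ)

/-- The codes of configurations. -/
abbrev Code : Type :=
  Option (Fin e.numLabels) × Fin e.numStates × (Fin e.numStacks → List (Fin e.numSymbols))

/-- The code of a family of stacks. -/
def encodeStacks (S : ∀ k, List (Γ k)) (i : Fin e.numStacks) : List (Fin e.numSymbols) :=
  (S (e.stack.symm i)).map fun x => e.symbol ⟨_, x⟩

/-- The code of a configuration. -/
def encode (c : Cfg Γ Λ σ) : e.Code :=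
  (c.l.map e.label, e.state c.var, e.encodeStacks c.stk)

theorem encodeStacks_update [DecidableEq K] (S : ∀ k, List (Γ k)) (k : K) (l : List (Γ k)) :
    e.encodeStacks (Function.update S k l) =
      Function.update (e.encodeStacks S) (e.stack k) (l.map fun x => e.symbol ⟨k, x⟩) := by
  ext1 i
  obtain ⟨k', rfl⟩ := e.stack.surjective i
  by_cases h : k' = k
  · subst h
    rw [Function.update_self, encodeStacks, Equiv.symm_apply_apply, Function.update_self]
  · rw [Function.update_of_ne (e.stack.injective.ne h), encodeStacks, encodeStacks,
      Equiv.symm_apply_apply, Function.update_of_ne h]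

theorem encodeStacks_stack (S : ∀ k, List (Γ k)) (k : K) :
    e.encodeStacks S (e.stack k) = (S k).map fun x => e.symbol ⟨k, x⟩ := by
  rw [encodeStacks, Equiv.symm_apply_apply]

open Classical in
/-- The symbol of the stack `k` and the set `A` with a given code. -/
noncomputable def decodeSymbol (A : Set (Σ k, Γ k)) (k : K) (i : Fin e.numSymbols) : Option (Γ k) :=
  if h : ∃ x : Γ k, (⟨k, x⟩ : Σ k, Γ k) ∈ A ∧ e.symbol ⟨k, x⟩ = i then some h.choose else none

theorem bind_decodeSymbol {A : Set (Σ k, Γ k)} (hA : Set.InjOn e.symbol A)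
    {S : ∀ k, List (Γ k)} (hS : StacksIn A S) (k : K) :
    (e.encodeStacks S (e.stack k)).head?.bind (e.decodeSymbol A k) = (S k).head? := by
  rw [encodeStacks_stack]
  rcases hk : S k with _ | ⟨x, l⟩
  · rfl
  · have hx : (⟨k, x⟩ : Σ k, Γ k) ∈ A := hS k x (by simp [hk])
    have h : ∃ y : Γ k, (⟨k, y⟩ : Σ k, Γ k) ∈ A ∧ e.symbol ⟨k, y⟩ = e.symbol ⟨k, x⟩ :=
      ⟨x, hx, rfl⟩
    have heq := hA h.choose_spec.1 hx h.choose_spec.2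
    simp only [Sigma.mk.injEq, heq_eq_eq, true_and] at heq
    simp [decodeSymbol, h, heq]

theorem primrec_update (i : Fin e.numStacks) :
    Primrec₂ fun (S : Fin e.numStacks → List (Fin e.numSymbols)) (l : List (Fin e.numSymbols)) =>
      Function.update S i l := by
  refine Primrec.fin_curry.2 ?_
  have h : Primrec fun p : ((Fin e.numStacks → List (Fin e.numSymbols)) × List (Fin e.numSymbols)) ×
      Fin e.numStacks => if p.2 = i then p.1.2 else p.1.1 p.2 :=
    Primrec.ite (by fun_prop) (by fun_prop)
      (Primrec.fin_app.comp (by fun_prop : Primrec fun p :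
        ((Fin e.numStacks → List (Fin e.numSymbols)) × List (Fin e.numSymbols)) ×
          Fin e.numStacks => p.1.1) (by fun_prop))
  exact h.of_eq fun p => by simp [Function.update_apply]

/-- One statement acts on the codes as a primitive recursive function, provided that distinct
symbols that can occur have distinct codes. -/
theorem exists_primrec_stepAux [DecidableEq K] {A : Set (Σ k, Γ k)} (hA : Set.InjOn e.symbol A)
    (q : Stmt Γ Λ σ) (hq : q.pushed ⊆ A) :
    ∃ g : Fin e.numStates × (Fin e.numStacks → List (Fin e.numSymbols)) → e.Code, Primrec g ∧
      ∀ v S, StacksIn A S → StacksIn A (stepAux q v S).stk ∧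
        g (e.state v, e.encodeStacks S) = e.encode (stepAux q v S) := by
  have happ (k : K) : Primrec fun p :
      Fin e.numStates × (Fin e.numStacks → List (Fin e.numSymbols)) => p.2 (e.stack k) :=
    Primrec.fin_app.comp Primrec.snd (Primrec.const _)
  have hupd (k : K) (f : σ → Option (Γ k) → σ) :
      Primrec fun p : Fin e.numStates × (Fin e.numStacks → List (Fin e.numSymbols)) =>
        e.state (f (e.state.symm p.1) ((p.2 (e.stack k)).head?.bind (e.decodeSymbol A k))) :=
    (Primrec.dom_finite fun p : Fin e.numStates × Option (Fin e.numSymbols) =>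
      e.state (f (e.state.symm p.1) (p.2.bind (e.decodeSymbol A k)))).comp
        (Primrec.fst.pair (Primrec.list_head?.comp (happ k)))
  induction q with
  | push k f q ih =>
    obtain ⟨g, hg, hgs⟩ := ih (Set.union_subset_iff.1 hq).2
    have hf (v : σ) : (⟨k, f v⟩ : Σ k, Γ k) ∈ A := (Set.union_subset_iff.1 hq).1 ⟨v, rfl⟩
    refine ⟨fun p => g (p.1, Function.update p.2 (e.stack k)
      (e.symbol ⟨k, f (e.state.symm p.1)⟩ :: p.2 (e.stack k))), ?_, fun v S hS => ?_⟩
    · exact hg.comp (Primrec.fst.pair ((e.primrec_update _).comp Primrec.snd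
        (Primrec.list_cons.comp ((Primrec.dom_finite fun v : Fin e.numStates =>
          e.symbol ⟨k, f (e.state.symm v)⟩).comp Primrec.fst) (happ k))))
    · have hS' : StacksIn A (Function.update S k (f v :: S k)) := hS.update fun x hx => by
        rcases List.mem_cons.1 hx with rfl | hx
        · exact hf v
        · exact hS k x hx
      obtain ⟨h₁, h₂⟩ := hgs v _ hS'
      refine ⟨by simpa using h₁, ?_⟩
      rw [stepAux, ← h₂, encodeStacks_update, List.map_cons]
      simp [encodeStacks_stack]
  | peek k f q ih =>
    obtain ⟨g, hg, hgs⟩ := ih hq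
    refine ⟨fun p => g (e.state (f (e.state.symm p.1)
      ((p.2 (e.stack k)).head?.bind (e.decodeSymbol A k))), p.2),
      hg.comp ((hupd k f).pair Primrec.snd), fun v S hS => ?_⟩
    obtain ⟨h₁, h₂⟩ := hgs (f v (S k).head?) _ hS
    refine ⟨by simpa using h₁, ?_⟩
    rw [stepAux, ← h₂]
    simp only [e.bind_decodeSymbol hA hS, Equiv.symm_apply_apply]
  | pop k f q ih =>
    obtain ⟨g, hg, hgs⟩ := ih hq
    refine ⟨fun p => g (e.state (f (e.state.symm p.1)
      ((p.2 (e.stack k)).head?.bind (e.decodeSymbol A k))),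
        Function.update p.2 (e.stack k) (p.2 (e.stack k)).tail),
      hg.comp ((hupd k f).pair ((e.primrec_update _).comp Primrec.snd
        (Primrec.list_tail.comp (happ k)))), fun v S hS => ?_⟩
    have hS' : StacksIn A (Function.update S k (S k).tail) :=
      hS.update fun x hx => hS k x (List.mem_of_mem_tail hx)
    obtain ⟨h₁, h₂⟩ := hgs (f v (S k).head?) _ hS'
    refine ⟨by simpa using h₁, ?_⟩
    rw [stepAux, ← h₂, encodeStacks_update]
    simp only [e.bind_decodeSymbol hA hS, Equiv.symm_apply_apply]
    rw [encodeStacks_stack, List.map_tail]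
  | load f q ih =>
    obtain ⟨g, hg, hgs⟩ := ih hq
    refine ⟨fun p => g (e.state (f (e.state.symm p.1)), p.2),
      hg.comp (((Primrec.dom_finite fun v : Fin e.numStates => e.state (f (e.state.symm v))).comp
        Primrec.fst).pair Primrec.snd), fun v S hS => ?_⟩
    obtain ⟨h₁, h₂⟩ := hgs (f v) _ hS
    refine ⟨by simpa using h₁, ?_⟩
    rw [stepAux, ← h₂]
    simp
  | branch f q₁ q₂ ih₁ ih₂ =>
    obtain ⟨g₁, hg₁, hgs₁⟩ := ih₁ (Set.union_subset_iff.1 hq).1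
    obtain ⟨g₂, hg₂, hgs₂⟩ := ih₂ (Set.union_subset_iff.1 hq).2
    refine ⟨fun p => bif f (e.state.symm p.1) then g₁ p else g₂ p,
      Primrec.cond ((Primrec.dom_finite fun v : Fin e.numStates => f (e.state.symm v)).comp
        Primrec.fst) hg₁ hg₂, fun v S hS => ?_⟩
    cases hf : f v with
    | true => simpa [stepAux, hf] using hgs₁ v S hS
    | false => simpa [stepAux, hf] using hgs₂ v S hS
  | goto f =>
    refine ⟨fun p => (some (e.label (f (e.state.symm p.1))), p), ?_, fun v S hS => ?_⟩
    · exact ((Primrec.dom_finite fun v : Fin e.numStates =>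
        some (e.label (f (e.state.symm v)))).comp Primrec.fst).pair Primrec.id
    · exact ⟨by simpa [stepAux] using hS, by simp [stepAux, encode]⟩
  | halt =>
    exact ⟨fun p => (none, p), (Primrec.const _).pair Primrec.id,
      fun v S hS => ⟨by simpa [stepAux] using hS, by simp [stepAux, encode]⟩⟩

/-- The step function of a machine is primitive recursive on the codes. A halted configuration
stays as it is. -/
theorem exists_primrec_step [DecidableEq K] {A : Set (Σ k, Γ k)} (hA : Set.InjOn e.symbol A)
    (M : Λ → Stmt Γ Λ σ) (hM : ∀ l, (M l).pushed ⊆ A) :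
    ∃ g : e.Code → e.Code, Primrec g ∧
      ∀ c : Cfg Γ Λ σ, StacksIn A c.stk → StacksIn A ((step M c).getD c).stk ∧
        g (e.encode c) = e.encode ((step M c).getD c) := by
  choose G hG hGs using fun l => e.exists_primrec_stepAux hA (M l) (hM l)
  refine ⟨fun p => p.1.elim p fun i => G (e.label.symm i) p.2, ?_, ?_⟩
  · have h : Primrec₂ fun (p : e.Code) (i : Fin e.numLabels) => G (e.label.symm i) p.2 := by
      have h1 : Primrec₂ fun (i : Fin e.numLabels)
          (p : Fin e.numStates × (Fin e.numStacks → List (Fin e.numSymbols))) =>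
          G (e.label.symm i) p :=
        Primrec.fin_curry₁.2 fun i => hG _
      exact h1.comp Primrec.snd (Primrec.snd.comp Primrec.fst)
    refine (Primrec.option_casesOn Primrec.fst Primrec.id h).of_eq fun p => ?_
    rcases p with ⟨_ | i, p⟩ <;> rfl
  · rintro ⟨_ | l, v, S⟩ hS
    · exact ⟨hS, rfl⟩
    · obtain ⟨h₁, h₂⟩ := hGs l v S hS
      exact ⟨h₁, by simpa [encode, step] using h₂⟩

end Coding

end Turing.TM2

namespace Turing

open TM2

theorem iterate_getD_of_evals {α : Type*} {f : α → Option α} {a b : α} (hb : f b = none) :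
    ∀ {n : ℕ}, (flip bind f)^[n] (some a) = some b → ∀ {N : ℕ}, n ≤ N →
      (fun c => (f c).getD c)^[N] a = b := by
  have hfix (N : ℕ) : (fun c => (f c).getD c)^[N] b = b :=
    Function.iterate_fixed (by simp [hb]) N
  have hnone (n : ℕ) : (flip bind f)^[n] none = none :=
    Function.iterate_fixed rfl n
  intro n
  induction n generalizing a with
  | zero =>
    intro h N _
    obtain rfl : a = b := by simpa using h
    exact hfix N
  | succ n ih =>
    intro h N hN
    obtain ⟨N, rfl⟩ : ∃ M, N = M + 1 := ⟨N - 1, by omega⟩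
    rw [Function.iterate_succ_apply] at h ⊢
    cases hfa : f a with
    | none =>
      have : (flip bind f) (some a) = none := hfa
      rw [this, hnone] at h
      exact absurd h (by simp)
    | some a' =>
      have : (flip bind f) (some a) = some a' := hfa
      rw [this] at h
      simpa [hfa] using ih h (N := N) (by omega)

/-- A function that a Turing machine computes in polynomial time is primitive recursive. Only the
input stack is required to have a finite alphabet, but a machine pushes only finitely many
symbols, and those are numbered. -/
theorem TM2ComputableInPolyTime.primrec {α β αΓ βΓ : Type} [Primcodable α] [Primcodable αΓ]
    [Finite αΓ] [Primcodable β] [Primcodable βΓ] [Finite βΓ] {ea : α → List αΓ} {eb : β → List βΓ}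
    {f : α → β} (h : TM2ComputableInPolyTime ea eb f) (hea : Primrec ea) :
    Primrec fun a => eb (f a) := by
  obtain ⟨⟨tm, ι, ω⟩, q, hout⟩ := h
  dsimp only at ι ω hout
  have := tm.ΛFin
  have := tm.σFin
  have := tm.kFin
  have := tm.Γk₀Fin
  let A : Set (Σ k, tm.Γ k) :=
    (⋃ l, (tm.m l).pushed) ∪ Set.range (fun x : tm.Γ tm.k₀ => (⟨tm.k₀, x⟩ : Σ k, tm.Γ k))
  have hAfin : A.Finite :=
    (Set.finite_iUnion fun l => (tm.m l).finite_pushed).union (Set.finite_range _)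
  have hAk : (A ∪ Set.range fun x : tm.Γ tm.k₁ => (⟨tm.k₁, x⟩ : Σ k, tm.Γ k)).Finite := by
    have : Finite (tm.Γ tm.k₁) := Finite.of_equiv _ ω.symm
    exact hAfin.union (Set.finite_range _)
  obtain ⟨N, φ, hφ⟩ : ∃ (N : ℕ) (φ : (Σ k, tm.Γ k) → Fin (N + 1)),
      Set.InjOn φ (A ∪ Set.range fun x : tm.Γ tm.k₁ => (⟨tm.k₁, x⟩ : Σ k, tm.Γ k)) := by
    classical
    have := hAk.to_subtype
    obtain ⟨N, ⟨e⟩⟩ := Finite.exists_equiv_fin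
      ↥(A ∪ Set.range fun x : tm.Γ tm.k₁ => (⟨tm.k₁, x⟩ : Σ k, tm.Γ k))
    refine ⟨N, fun x => if hx : x ∈ _ then (e ⟨x, hx⟩).castSucc else 0, fun x hx y hy hxy => ?_⟩
    dsimp only at hxy
    rw [dif_pos hx, dif_pos hy] at hxy
    simpa using hxy
  let e : Coding tm.Γ tm.Λ tm.σ :=
    { numLabels := _
      numStates := _
      numStacks := _
      label := Finite.equivFin _
      state := Finite.equivFin _
      stack := Finite.equivFin _
      numSymbols := N + 1
      symbol := φ }
  obtain ⟨g, hg, hgs⟩ := e.exists_primrec_step (hφ.mono Set.subset_union_left) tm.m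
    fun l => (Set.subset_iUnion (fun l => (tm.m l).pushed) l).trans Set.subset_union_left
  have hiter (n : ℕ) (c : tm.Cfg) (hc : StacksIn A c.stk) :
      g^[n] (e.encode c) = e.encode ((fun c => (step tm.m c).getD c)^[n] c) := by
    induction n generalizing c with
    | zero => rfl
    | succ n ih =>
      rw [Function.iterate_succ_apply, (hgs c hc).2]
      exact ih _ (hgs c hc).1
  let dec : Fin (N + 1) → Option βΓ := fun i =>
    (e.decodeSymbol (A ∪ Set.range fun x : tm.Γ tm.k₁ => (⟨tm.k₁, x⟩ : Σ k, tm.Γ k))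
      tm.k₁ i).map ω
  have hdec (y : βΓ) : dec (φ ⟨tm.k₁, ω.symm y⟩) = some y := by
    have := e.bind_decodeSymbol hφ
      (S := Function.update (fun _ => []) tm.k₁ [ω.symm y])
      (StacksIn.update (fun k x hx => by simp at hx) fun x _ => Or.inr ⟨x, rfl⟩) tm.k₁
    simp only [Coding.encodeStacks_stack, Function.update_self, List.map_cons, List.map_nil,
      List.head?_cons, Option.bind_some] at this
    have h2 : e.decodeSymbol (A ∪ Set.range fun x : tm.Γ tm.k₁ => (⟨tm.k₁, x⟩ : Σ k, tm.Γ k))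
      tm.k₁ (φ ⟨tm.k₁, ω.symm y⟩) = some (ω.symm y) := this
    simp only [dec, h2, Option.map_some, Equiv.apply_symm_apply]
  let start : List αΓ → e.Code := fun l =>
    (some (e.label tm.main), e.state tm.initialState,
      Function.update (fun _ => []) (e.stack tm.k₀) (l.map fun x => φ ⟨tm.k₀, ι.symm x⟩))
  have hstart : Primrec start := by
    refine (Primrec.const _).pair ((Primrec.const _).pair ?_)
    exact (e.primrec_update _).comp (Primrec.const _)
      (Primrec.list_map Primrec.id ((Primrec.dom_finite fun x => φ ⟨tm.k₀, ι.symm x⟩).comp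
        Primrec.snd))
  have hinit (l : List αΓ) : e.encode (initList tm (l.map ι.invFun)) = start l := by
    have : (initList tm (l.map ι.invFun)).stk =
        Function.update (fun _ => []) tm.k₀ (l.map ι.symm) := by
      ext1 k
      by_cases hk : k = tm.k₀
      · subst hk
        simp [initList]
      · simp [initList, hk]
    refine Prod.ext rfl (Prod.ext rfl ?_)
    change e.encodeStacks (initList tm (l.map ι.invFun)).stk = _
    rw [this, Coding.encodeStacks_update, List.map_map]
    rfl
  have hstartA (l : List αΓ) : StacksIn A (initList tm (l.map ι.invFun)).stk := by
    intro k x hx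
    by_cases hk : k = tm.k₀
    · subst hk
      exact Or.inr ⟨x, rfl⟩
    · simp [initList, hk] at hx
  have key (a : α) : (g^[q.eval (ea a).length] (start (ea a))).2.2 (e.stack tm.k₁) =
      (eb (f a)).map fun y => φ ⟨tm.k₁, ω.symm y⟩ := by
    obtain ⟨⟨n, hn⟩, hnq⟩ := hout a
    have hrun := iterate_getD_of_evals (f := step tm.m) (b := haltList tm
      ((eb (f a)).map ω.invFun)) rfl hn hnq
    rw [← hinit, hiter _ _ (hstartA _)]
    have hrun' : (fun c => (step tm.m c).getD c)^[q.eval (ea a).length]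
      (initList tm ((ea a).map ι.invFun)) = haltList tm ((eb (f a)).map ω.invFun) := hrun
    rw [hrun']
    change e.encodeStacks (haltList tm ((eb (f a)).map ω.invFun)).stk (e.stack tm.k₁) = _
    rw [Coding.encodeStacks_stack]
    simp [haltList, e]
  have hresult : Primrec fun a =>
      ((g^[q.eval (ea a).length] (start (ea a))).2.2 (e.stack tm.k₁)).flatMap
        fun i => (dec i).toList := by
    refine Primrec.list_flatMap (Primrec.fin_app.comp (Primrec.snd.comp (Primrec.snd.comp
      (Primrec.nat_iterate ((Primrec.polynomial_eval q).comp (Primrec.list_length.comp hea))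
        (hstart.comp hea) (hg.comp Primrec.snd)))) (Primrec.const _)) ?_
    exact Primrec.optionToList.comp ((Primrec.dom_finite dec).comp Primrec.snd)
  refine hresult.of_eq fun a => ?_
  rw [key]
  induction eb (f a) with
  | nil => rfl
  | cons y l ih => simp only [List.map_cons, List.flatMap_cons, hdec, ih]; rfl

end Turing

noncomputable section

namespace Bosonic

open Complex (I)

/-! ### Codes of finite superpositions -/

/-- The squared norm `∏ nⱼ! 2 ^ nⱼ` of a rescaled Fock state. -/
def weight {m : ℕ} (n : Fin m → ℕ) : ℕ := ∏ j, (n j).factorial * 2 ^ n j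

/-- The Fock state `|n₁, …, nₘ⟩`, rescaled in such a way that the matrix elements of the quadratures
are Gaussian rationals. -/
def scaledKet {m : ℕ} (n : Fin m → ℕ) : FiniteState m :=
  Finsupp.single n ((√(weight n : ℝ) : ℝ) : ℂ)

/-- A term `(q, n, d, κ)` stands for `i ^ q * n / 2 ^ d` times the rescaled Fock state with the
photon numbers listed in `κ`. -/
abbrev StateTerm : Type := ℕ × ℕ × ℕ × List ℕ

/-- A code is a formal sum of terms. It stands for a finite superposition with coefficients in
`ℤ[i, 1/2]`. -/
abbrev StateCode : Type := List StateTerm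

/-- The photon numbers of `m` modes listed in `κ`. -/
def occupation (m : ℕ) (κ : List ℕ) : Fin m → ℕ := fun j => κ.getD j 0

/-- The number `i ^ q * n / 2 ^ d`. -/
def dyadic (q n d : ℕ) : ℂ := I ^ q * n / 2 ^ d

/-- The vector that a term stands for. -/
def termState (m : ℕ) (t : StateTerm) : FiniteState m :=
  dyadic t.1 t.2.1 t.2.2.1 • scaledKet (occupation m t.2.2.2)

/-- The vector that a code stands for. -/
def codeState (m : ℕ) (c : StateCode) : FiniteState m := (c.map (termState m)).sum

@[simp] theorem codeState_nil (m : ℕ) : codeState m [] = 0 := rfl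

@[simp] theorem codeState_cons (m : ℕ) (t : StateTerm) (c : StateCode) :
    codeState m (t :: c) = termState m t + codeState m c := by
  simp [codeState]

@[simp] theorem codeState_append (m : ℕ) (c c' : StateCode) :
    codeState m (c ++ c') = codeState m c + codeState m c' := by
  simp [codeState]

theorem codeState_flatMap {m : ℕ} {α : Type*} (l : List α) (f : α → StateCode) :
    codeState m (l.flatMap f) = (l.map fun a => codeState m (f a)).sum := by
  induction l with
  | nil => rfl
  | cons a l ih => simp [ih]

theorem dyadic_mul (q n d q' n' d' : ℕ) :
    dyadic q n d * dyadic q' n' d' = dyadic (q + q') (n * n') (d + d') := by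
  simp only [dyadic, pow_add, Nat.cast_mul]
  ring

/-- The product of a code with the number `i ^ q * n / 2 ^ d`. -/
def scaleCode (q n d : ℕ) (c : StateCode) : StateCode :=
  c.map fun t => (t.1 + q, t.2.1 * n, t.2.2.1 + d, t.2.2.2)

@[simp] theorem codeState_scaleCode (m q n d : ℕ) (c : StateCode) :
    codeState m (scaleCode q n d c) = dyadic q n d • codeState m c := by
  induction c with
  | nil => simp [scaleCode]
  | cons t c ih =>
    rw [scaleCode] at ih
    simp only [scaleCode, List.map_cons, codeState_cons, ih, smul_add]
    congr 1
    simp only [termState, smul_smul, dyadic_mul]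
    congr 2 <;> ring

/-- The code of the vacuum. -/
def vacuumCode : StateCode := [(0, 1, 0, [])]

theorem toFock_vacuumCode (m : ℕ) : toFock m (codeState m vacuumCode) = vacuum m := by
  have h : occupation m [] = 0 := by ext; simp [occupation]
  simp [vacuumCode, termState, dyadic, h, scaledKet, weight, toFock, vacuum]

/-! ### The quadratures on codes -/

theorem weight_update_succ {m : ℕ} (n : Fin m → ℕ) (j : Fin m) :
    weight (Function.update n j (n j + 1)) = weight n * (2 * (n j + 1)) := by
  simp only [weight, ← Finset.mul_prod_erase Finset.univ _ (Finset.mem_univ j),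
    Function.update_self]
  have : ∏ x ∈ Finset.univ.erase j,
      (Function.update n j (n j + 1) x).factorial * 2 ^ Function.update n j (n j + 1) x =
      ∏ x ∈ Finset.univ.erase j, (n x).factorial * 2 ^ n x := by
    refine Finset.prod_congr rfl fun x hx => ?_
    rw [Function.update_of_ne (Finset.ne_of_mem_erase hx)]
  rw [this, Nat.factorial_succ, pow_succ]
  ring

theorem weight_pos {m : ℕ} (n : Fin m → ℕ) : 0 < weight n :=
  Finset.prod_pos fun j _ => by positivity

theorem creation_scaledKet {m : ℕ} (j : Fin m) (n : Fin m → ℕ) :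
    creation j (scaledKet n) =
      (1 / ((√2 : ℝ) : ℂ)) • scaledKet (Function.update n j (n j + 1)) := by
  have h2 : √2 ≠ 0 := by positivity
  have h : √(weight n : ℝ) * √(n j + 1 : ℝ) =
      1 / √2 * √(weight (Function.update n j (n j + 1)) : ℝ) := by
    rw [weight_update_succ]
    push_cast
    rw [Real.sqrt_mul (by positivity), Real.sqrt_mul (by positivity)]
    field_simp
  simp only [creation, scaledKet, Finsupp.linearCombination_single, Finsupp.smul_single,
    smul_eq_mul]
  exact congrArg (Finsupp.single _) (by exact_mod_cast congrArg Complex.ofReal h)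

theorem annihilation_scaledKet {m : ℕ} (j : Fin m) (n : Fin m → ℕ) :
    annihilation j (scaledKet n) =
      (((√2 : ℝ) : ℂ) * n j) • scaledKet (Function.update n j (n j - 1)) := by
  have h : √(weight n : ℝ) * √(n j : ℝ) =
      √2 * n j * √(weight (Function.update n j (n j - 1)) : ℝ) := by
    rcases hn : n j with _ | k
    · simp
    · have hw := weight_update_succ (Function.update n j k) j
      rw [Function.update_self, Function.update_idem, ← hn, Function.update_eq_self] at hw
      rw [hn] at hw
      rw [hw, Nat.add_sub_cancel]
      push_cast
      rw [Real.sqrt_mul (by positivity), Real.sqrt_mul (by positivity)]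
      have := Real.mul_self_sqrt (show (0 : ℝ) ≤ k + 1 by positivity)
      linear_combination (√(weight (Function.update n j k) : ℝ) * √2) * this
  simp only [annihilation, scaledKet, Finsupp.linearCombination_single, Finsupp.smul_single,
    smul_eq_mul]
  exact congrArg (Finsupp.single _) (by exact_mod_cast congrArg Complex.ofReal h)

theorem sqrt_two_mul_self : ((√2 : ℝ) : ℂ) * ((√2 : ℝ) : ℂ) = 2 := by
  rw [← Complex.ofReal_mul, Real.mul_self_sqrt (by norm_num)]
  norm_num

theorem sqrt_two_ne_zero : ((√2 : ℝ) : ℂ) ≠ 0 := by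
  exact_mod_cast (by positivity : √2 ≠ 0)

theorem position_scaledKet {m : ℕ} (j : Fin m) (n : Fin m → ℕ) :
    position j (scaledKet n) = dyadic 0 (n j) 0 • scaledKet (Function.update n j (n j - 1)) +
      dyadic 0 1 1 • scaledKet (Function.update n j (n j + 1)) := by
  have h2 := sqrt_two_ne_zero
  simp only [position, LinearMap.smul_apply, LinearMap.add_apply, annihilation_scaledKet,
    creation_scaledKet, smul_add, smul_smul, dyadic]
  congr 2
  · field_simp
  · have := sqrt_two_mul_self
    field_simp
    rw [sq, this]
    norm_num

theorem momentum_scaledKet {m : ℕ} (j : Fin m) (n : Fin m → ℕ) :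
    momentum j (scaledKet n) = dyadic 3 (n j) 0 • scaledKet (Function.update n j (n j - 1)) +
      dyadic 1 1 1 • scaledKet (Function.update n j (n j + 1)) := by
  have h2 := sqrt_two_ne_zero
  simp only [momentum, LinearMap.smul_apply, LinearMap.sub_apply, annihilation_scaledKet,
    creation_scaledKet, smul_sub, smul_smul, dyadic]
  rw [sub_eq_add_neg, ← neg_smul]
  congr 2
  · field_simp
    rw [Complex.I_pow_four, one_mul]
  · have := sqrt_two_mul_self
    field_simp
    rw [Complex.I_sq]
    linear_combination this

/-- The list of the photon numbers of `m` modes, the one of mode `j` being replaced by `v`. -/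
def setOccupation (m : ℕ) (κ : List ℕ) (j v : ℕ) : List ℕ :=
  (List.range m).map fun i => if i = j then v else κ.getD i 0

theorem occupation_setOccupation {m : ℕ} (κ : List ℕ) (j : Fin m) (v : ℕ) :
    occupation m (setOccupation m κ j v) = Function.update (occupation m κ) j v := by
  ext i
  simp [occupation, setOccupation, Function.update_apply, Fin.ext_iff]

/-- The letter `u` stands for the quadrature `R_u`. -/
def letterOp (m u : ℕ) : Module.End ℂ (FiniteState m) :=
  if h : u < m + m then quadrature ⟨u, h⟩ else 0

/-- A word stands for a product of quadratures. -/
def wordOp (m : ℕ) (w : List ℕ) : Module.End ℂ (FiniteState m) := (w.map (letterOp m)).prod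

/-- The action of the quadrature `R_u` on a term. -/
def letterAct (m u : ℕ) (t : StateTerm) : StateCode :=
  if u < m then
    [(t.1, t.2.1 * t.2.2.2.getD u 0, t.2.2.1, setOccupation m t.2.2.2 u (t.2.2.2.getD u 0 - 1)),
      (t.1, t.2.1, t.2.2.1 + 1, setOccupation m t.2.2.2 u (t.2.2.2.getD u 0 + 1))]
  else
    [(t.1 + 3, t.2.1 * t.2.2.2.getD (u - m) 0, t.2.2.1,
        setOccupation m t.2.2.2 (u - m) (t.2.2.2.getD (u - m) 0 - 1)),
      (t.1 + 1, t.2.1, t.2.2.1 + 1,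
        setOccupation m t.2.2.2 (u - m) (t.2.2.2.getD (u - m) 0 + 1))]

/-- The action of a word on a code. -/
def wordAct (m : ℕ) (w : List ℕ) (c : StateCode) : StateCode :=
  w.foldr (fun u c => c.flatMap (letterAct m u)) c

theorem codeState_letterAct {m u : ℕ} (hu : u < m + m) (t : StateTerm) :
    codeState m (letterAct m u t) = letterOp m u (termState m t) := by
  obtain ⟨q, n, d, κ⟩ := t
  by_cases h : u < m
  · have hq : quadrature ⟨u, hu⟩ = position (⟨u, h⟩ : Fin m) := by
      rw [quadrature, ← Fin.append_left position momentum]; rfl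
    rw [letterOp, dif_pos hu, hq, termState, map_smul, position_scaledKet, letterAct, if_pos h]
    simp only [codeState_cons, codeState_nil, add_zero, termState, smul_add, smul_smul,
      dyadic_mul]
    have h1 (v : ℕ) := occupation_setOccupation κ (⟨u, h⟩ : Fin m) v
    simp only at h1
    simp only [h1]
    simp [occupation]
  · have hu' : u - m < m := by omega
    have hq : quadrature ⟨u, hu⟩ = momentum (⟨u - m, hu'⟩ : Fin m) := by
      rw [quadrature, ← Fin.append_right position momentum]
      congr 1
      ext
      simp
      omega
    rw [letterOp, dif_pos hu, hq, termState, map_smul, momentum_scaledKet, letterAct, if_neg h]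
    simp only [codeState_cons, codeState_nil, add_zero, termState, smul_add, smul_smul,
      dyadic_mul]
    have h1 (v : ℕ) := occupation_setOccupation κ (⟨u - m, hu'⟩ : Fin m) v
    simp only at h1
    simp only [h1]
    simp [occupation]

theorem codeState_wordAct {m : ℕ} {w : List ℕ} (hw : ∀ u ∈ w, u < m + m) (c : StateCode) :
    codeState m (wordAct m w c) = wordOp m w (codeState m c) := by
  induction w with
  | nil => simp [wordAct, wordOp]
  | cons u w ih =>
    have ih := ih fun v hv => hw v (List.mem_cons_of_mem _ hv)
    rw [wordAct] at ih
    rw [wordAct, List.foldr_cons, codeState_flatMap, wordOp, List.map_cons, List.prod_cons,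
      Module.End.mul_apply, ← wordOp, ← ih, codeState, map_list_sum, List.map_map]
    congr 1
    exact List.map_congr_left fun t _ => codeState_letterAct (hw u List.mem_cons_self) t

/-! ### Norms of coded states -/

/-- The inner product of two rescaled Fock states. -/
def overlap (m : ℕ) (κ κ' : List ℕ) : ℕ :=
  ((List.range m).map fun j =>
    if κ.getD j 0 = κ'.getD j 0 then (κ.getD j 0).factorial * 2 ^ κ.getD j 0 else 0).prod

theorem overlap_eq (m : ℕ) (κ κ' : List ℕ) :
    overlap m κ κ' =
      if occupation m κ = occupation m κ' then weight (occupation m κ) else 0 := by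
  rw [overlap, ← List.map_coe_finRange_eq_range, List.map_map, ← List.ofFn_eq_map, List.prod_ofFn]
  simp only [Function.comp_def]
  split_ifs with h
  · refine Finset.prod_congr rfl fun j _ => ?_
    exact if_pos (congrFun h j)
  · obtain ⟨j, hj⟩ := Function.ne_iff.1 h
    exact Finset.prod_eq_zero (Finset.mem_univ j) (if_neg hj)

theorem toFock_scaledKet {m : ℕ} (n : Fin m → ℕ) :
    toFock m (scaledKet n) = ((√(weight n : ℝ) : ℝ) : ℂ) • ket n := by
  simp [toFock, scaledKet]

theorem inner_ket {m : ℕ} (n n' : Fin m → ℕ) :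
    inner ℂ (ket n) (ket n') = if n = n' then (1 : ℂ) else 0 := by
  rw [ket, lp.inner_single_left, ket, lp.single_apply, Pi.single_apply]
  split_ifs <;> simp

theorem inner_scaledKet (m : ℕ) (κ κ' : List ℕ) :
    inner ℂ (toFock m (scaledKet (occupation m κ))) (toFock m (scaledKet (occupation m κ'))) =
      (overlap m κ κ' : ℂ) := by
  rw [toFock_scaledKet, toFock_scaledKet, inner_smul_left, inner_smul_right, inner_ket, overlap_eq]
  split_ifs with h
  · rw [← h, Complex.conj_ofReal, mul_one, ← Complex.ofReal_mul,
      Real.mul_self_sqrt (Nat.cast_nonneg _)]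
    simp
  · simp

/-- The exponent of a common denominator of the coefficients of a code. -/
def denominator (c : StateCode) : ℕ := (c.map fun t => t.2.2.1).sum

/-- Up to the factor `4 ^ denominator c`, the part of the double sum `‖c‖² = ∑ ⟨t, t'⟩` over those
terms `t`, `t'` whose inner product has the phase `i ^ (-q)`. -/
def gram (m q : ℕ) (c : StateCode) : ℕ :=
  (c.map fun t => (c.map fun t' => if (t'.1 + 3 * t.1 + q) % 4 = 0 then
    t.2.1 * t'.2.1 * 2 ^ (2 * denominator c - (t.2.2.1 + t'.2.2.1)) *
      overlap m t.2.2.2 t'.2.2.2 else 0).sum).sum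

theorem inner_list_sum {E : Type*} [NormedAddCommGroup E] [InnerProductSpace ℂ E] (l : List E) :
    inner ℂ l.sum l.sum = (l.map fun x => (l.map fun y => inner ℂ x y).sum).sum := by
  have h1 (l : List E) (z : E) : inner ℂ z l.sum = (l.map fun y => inner ℂ z y).sum := by
    induction l with
    | nil => simp
    | cons x l ih => simp [ih]
  have h2 (l : List E) (z : E) : inner ℂ l.sum z = (l.map fun y => inner ℂ y z).sum := by
    induction l with
    | nil => simp
    | cons x l ih => simp [ih]
  rw [h2]
  simp only [h1]

theorem re_I_pow (a : ℕ) :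
    (I ^ a).re = (if a % 4 = 0 then 1 else 0) - (if (a + 2) % 4 = 0 then 1 else 0) := by
  have h : I ^ a = I ^ (a % 4) := by
    conv_lhs => rw [← Nat.div_add_mod a 4, pow_add, pow_mul, Complex.I_pow_four, one_pow, one_mul]
  rw [h]
  have h4 : a % 4 < 4 := Nat.mod_lt _ (by norm_num)
  rw [Nat.add_mod]
  interval_cases a % 4 <;> simp [pow_succ]

theorem re_inner_termState (m : ℕ) (t t' : StateTerm) {D : ℕ} (hD : t.2.2.1 + t'.2.2.1 ≤ 2 * D) :
    (inner ℂ (toFock m (termState m t)) (toFock m (termState m t'))).re * 4 ^ D =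
      ((if (t'.1 + 3 * t.1 + 0) % 4 = 0 then
        t.2.1 * t'.2.1 * 2 ^ (2 * D - (t.2.2.1 + t'.2.2.1)) *
          overlap m t.2.2.2 t'.2.2.2 else 0 : ℕ) : ℝ) -
      ((if (t'.1 + 3 * t.1 + 2) % 4 = 0 then
        t.2.1 * t'.2.1 * 2 ^ (2 * D - (t.2.2.1 + t'.2.2.1)) *
          overlap m t.2.2.2 t'.2.2.2 else 0 : ℕ) : ℝ) := by
  obtain ⟨q, n, d, κ⟩ := t
  obtain ⟨q', n', d', κ'⟩ := t'
  simp only at hD ⊢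
  have hI : (starRingEnd ℂ) I = I ^ 3 := by rw [Complex.conj_I, pow_succ, Complex.I_sq]; ring
  have h1 : inner ℂ (toFock m (termState m (q, n, d, κ)))
      (toFock m (termState m (q', n', d', κ'))) =
      ((n * n' * overlap m κ κ' / 2 ^ (d + d') : ℝ) : ℂ) * I ^ (q' + 3 * q) := by
    simp only [termState, map_smul, inner_smul_left, inner_smul_right, inner_scaledKet, dyadic,
      map_div₀, map_mul, map_pow, hI, Complex.conj_natCast, pow_add, pow_mul]
    have : (starRingEnd ℂ) 2 = 2 := Complex.conj_ofNat 2
    rw [this]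
    push_cast
    ring
  have h2 : (2 : ℝ) ^ (2 * D - (d + d')) = 4 ^ D / 2 ^ (d + d') := by
    rw [pow_sub₀ _ two_ne_zero hD, pow_mul]
    norm_num [div_eq_mul_inv]
  rw [h1, Complex.re_ofReal_mul, re_I_pow]
  push_cast
  rw [h2, add_zero]
  split_ifs <;> ring

theorem le_denominator {c : StateCode} {t : StateTerm} (ht : t ∈ c) :
    t.2.2.1 ≤ denominator c :=
  List.le_sum_of_mem (List.mem_map_of_mem ht)

/-- The squared norm of a coded state is computed exactly. -/
theorem norm_sq_codeState (m : ℕ) (c : StateCode) :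
    ‖toFock m (codeState m c)‖ ^ 2 * 4 ^ denominator c = (gram m 0 c : ℝ) - gram m 2 c := by
  have hre (l : List ℂ) : l.sum.re = (l.map Complex.re).sum := map_list_sum Complex.reAddGroupHom l
  have hsub {α : Type} (l : List α) (f g : α → ℝ) :
      (l.map f).sum - (l.map g).sum = (l.map fun a => f a - g a).sum := by
    induction l with
    | nil => simp
    | cons a l ih => simp only [List.map_cons, List.sum_cons, ← ih]; ring
  rw [← inner_self_eq_norm_sq (𝕜 := ℂ), codeState, map_list_sum, List.map_map, inner_list_sum,
    gram, gram]
  simp only [RCLike.re_to_complex, hre, List.map_map, Function.comp_def, Nat.cast_list_sum, hsub,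
    ← List.sum_map_mul_right]
  refine congrArg List.sum (List.map_congr_left fun t ht => congrArg List.sum
    (List.map_congr_left fun t' ht' => re_inner_termState m t t' ?_))
  have := le_denominator ht
  have := le_denominator ht'
  omega

/-- The test for `‖c‖ ≤ 2 ^ (-s)`. -/
def NormLE (m s : ℕ) (c : StateCode) : Prop :=
  gram m 0 c * 4 ^ s ≤ gram m 2 c * 4 ^ s + 4 ^ denominator c

instance (m s : ℕ) (c : StateCode) : Decidable (NormLE m s c) := by
  unfold NormLE; infer_instance

theorem normLE_iff (m s : ℕ) (c : StateCode) :
    NormLE m s c ↔ ‖toFock m (codeState m c)‖ ≤ 1 / 2 ^ s := by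
  have h := norm_sq_codeState m c
  have hD : (0 : ℝ) < 4 ^ denominator c := by positivity
  have hs : (0 : ℝ) < 4 ^ s := by positivity
  have h4 : (1 / 2 ^ s : ℝ) ^ 2 = 1 / 4 ^ s := by
    rw [div_pow, one_pow, ← pow_mul, mul_comm, pow_mul]; norm_num
  rw [NormLE, ← Nat.cast_le (α := ℝ), ← sq_le_sq₀ (norm_nonneg _) (by positivity), h4,
    le_div_iff₀ hs, ← mul_le_iff_le_one_left hD, mul_right_comm, h]
  push_cast
  rw [sub_mul, sub_le_iff_le_add']

/-- An upper bound for the norm of a coded state. -/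
def normBound (m : ℕ) (c : StateCode) : ℕ :=
  (c.map fun t => t.2.1 * overlap m t.2.2.2 t.2.2.2).sum

theorem norm_ket {m : ℕ} (n : Fin m → ℕ) : ‖ket n‖ = 1 := by
  simp [ket]

theorem norm_codeState_le (m : ℕ) (c : StateCode) :
    ‖toFock m (codeState m c)‖ ≤ normBound m c := by
  induction c with
  | nil => simp [normBound]
  | cons t c ih =>
    rw [codeState_cons, map_add, normBound, List.map_cons, List.sum_cons, Nat.cast_add]
    refine (norm_add_le _ _).trans (add_le_add ?_ ih)
    have hw : √(weight (occupation m t.2.2.2) : ℝ) ≤ weight (occupation m t.2.2.2) := by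
      have h1 : (1 : ℝ) ≤ weight (occupation m t.2.2.2) := by
        exact_mod_cast weight_pos _
      exact Real.sqrt_le_iff.2 ⟨by positivity, by nlinarith⟩
    have hd : (1 : ℝ) ≤ 2 ^ t.2.2.1 := one_le_pow₀ (by norm_num)
    rw [termState, map_smul, toFock_scaledKet, norm_smul, norm_smul, norm_ket, mul_one, overlap_eq,
      if_pos rfl, Nat.cast_mul, dyadic]
    simp only [norm_div, norm_mul, norm_pow, Complex.norm_I, one_pow, one_mul,
      Complex.norm_natCast, Complex.norm_ofNat, Complex.norm_real, Real.norm_eq_abs,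
      abs_of_nonneg (Real.sqrt_nonneg _)]
    gcongr
    exact div_le_self (Nat.cast_nonneg _) hd

/-! ### Density of the coded states in the graph norm -/

theorem dyadic_int (z : ℤ) (d : ℕ) :
    dyadic (if z < 0 then 2 else 0) z.natAbs d = (z : ℂ) / 2 ^ d := by
  rw [dyadic]
  congr 1
  split_ifs with h
  · have h1 : (z.natAbs : ℤ) = -z := by omega
    have h2 : ((z.natAbs : ℕ) : ℂ) = -(z : ℂ) := by rw [← Int.cast_natCast, h1, Int.cast_neg]
    rw [h2, Complex.I_sq]
    ring
  · have h1 : (z.natAbs : ℤ) = z := by omega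
    have h2 : ((z.natAbs : ℕ) : ℂ) = (z : ℂ) := by rw [← Int.cast_natCast, h1]
    rw [h2, pow_zero, one_mul]

theorem dyadic_succ (q n d : ℕ) : dyadic (q + 1) n d = I * dyadic q n d := by
  rw [dyadic, dyadic, pow_succ]
  ring

/-- The real and the imaginary part are rounded down to multiples of `2 ^ (-d)`. -/
theorem exists_dyadic_near (z : ℂ) {ε : ℝ} (hε : 0 < ε) :
    ∃ q n q' n' d, ‖dyadic q n d + dyadic q' n' d - z‖ < ε := by
  obtain ⟨d, hd⟩ := exists_pow_lt_of_lt_one (half_pos hε) (by norm_num : (1 / 2 : ℝ) < 1)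
  have hfloor (x : ℝ) : |(⌊x * 2 ^ d⌋ : ℝ) / 2 ^ d - x| ≤ (1 / 2) ^ d := by
    have h2 : (0 : ℝ) < 2 ^ d := by positivity
    have h1 := Int.floor_le (x * 2 ^ d)
    have h3 := Int.lt_floor_add_one (x * 2 ^ d)
    rw [div_sub' h2.ne', abs_div, abs_of_pos h2, one_div_pow]
    refine div_le_div_of_nonneg_right ?_ h2.le
    rw [abs_le]
    constructor <;> linarith
  refine ⟨if ⌊z.re * 2 ^ d⌋ < 0 then 2 else 0, ⌊z.re * 2 ^ d⌋.natAbs,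
    (if ⌊z.im * 2 ^ d⌋ < 0 then 2 else 0) + 1, ⌊z.im * 2 ^ d⌋.natAbs, d, ?_⟩
  rw [dyadic_succ, dyadic_int, dyadic_int]
  have h : ((⌊z.re * 2 ^ d⌋ : ℤ) : ℂ) / 2 ^ d + I * (((⌊z.im * 2 ^ d⌋ : ℤ) : ℂ) / 2 ^ d) - z =
      (((⌊z.re * 2 ^ d⌋ : ℝ) / 2 ^ d - z.re : ℝ) : ℂ) +
        I * (((⌊z.im * 2 ^ d⌋ : ℝ) / 2 ^ d - z.im : ℝ) : ℂ) := by
    conv_lhs => rw [← Complex.re_add_im z]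
    push_cast
    simp only [Complex.add_re, Complex.add_im, Complex.ofReal_re, Complex.ofReal_im,
      Complex.re_ofReal_mul, Complex.im_ofReal_mul, Complex.I_re, Complex.I_im]
    simp only [mul_zero, mul_one, add_zero, zero_add]
    ring
  rw [h]
  refine (norm_add_le _ _).trans_lt ?_
  rw [norm_mul, Complex.norm_I, one_mul, Complex.norm_real, Complex.norm_real, Real.norm_eq_abs,
    Real.norm_eq_abs]
  linarith [hfloor z.re, hfloor z.im]

theorem exists_codeState_near {m : ℕ} (T : Module.End ℂ (FiniteState m)) (f : FiniteState m)
    {ε : ℝ} (hε : 0 < ε) :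
    ∃ c, ‖toFock m (codeState m c) - toFock m f‖ < ε ∧
      ‖toFock m (T (codeState m c)) - toFock m (T f)‖ < ε := by
  induction f using Finsupp.induction_linear generalizing ε with
  | zero => exact ⟨[], by simpa using hε, by simpa using hε⟩
  | add f g hf hg =>
    obtain ⟨c, h1, h2⟩ := hf (half_pos hε)
    obtain ⟨c', h1', h2'⟩ := hg (half_pos hε)
    refine ⟨c ++ c', ?_, ?_⟩
    · rw [codeState_append, map_add, map_add, add_sub_add_comm]
      exact (norm_add_le _ _).trans_lt (by linarith)
    · rw [codeState_append, map_add, map_add, map_add, map_add, add_sub_add_comm]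
      exact (norm_add_le _ _).trans_lt (by linarith)
  | single n z =>
    have hw : ((√(weight n : ℝ) : ℝ) : ℂ) ≠ 0 := by
      have : (0 : ℝ) < weight n := by exact_mod_cast weight_pos n
      exact_mod_cast (Real.sqrt_pos.2 this).ne'
    have hn : Finsupp.single n z = (z / ((√(weight n : ℝ) : ℝ) : ℂ)) • scaledKet n := by
      rw [scaledKet, Finsupp.smul_single, smul_eq_mul, div_mul_cancel₀ _ hw]
    set x := toFock m (scaledKet n)
    set y := toFock m (T (scaledKet n))
    have hB : 0 < ‖x‖ + ‖y‖ + 1 := by positivity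
    obtain ⟨q, k, q', k', d, hd⟩ :=
      exists_dyadic_near (z / ((√(weight n : ℝ) : ℝ) : ℂ)) (div_pos hε hB)
    have hocc : occupation m (List.ofFn n) = n := by
      ext j
      simp [occupation]
    refine ⟨[(q, k, d, List.ofFn n), (q', k', d, List.ofFn n)], ?_, ?_⟩
    all_goals
      simp only [codeState_cons, codeState_nil, add_zero, termState, hocc, hn, ← add_smul,
        map_smul, ← sub_smul, norm_smul]
      rw [lt_div_iff₀ hB] at hd
      refine lt_of_le_of_lt (mul_le_mul_of_nonneg_left ?_ (norm_nonneg _)) hd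
    · change ‖x‖ ≤ _
      linarith [norm_nonneg y]
    · change ‖y‖ ≤ _
      linarith [norm_nonneg x]

theorem mem_graph_unboundedOp {m : ℕ} {T : Module.End ℂ (FiniteState m)} {φ χ : Fock m} :
    (φ, χ) ∈ (unboundedOp T).graph ↔ ∃ f, toFock m f = φ ∧ toFock m (T f) = χ := by
  rw [LinearPMap.mem_graph_iff]
  have h (f : FiniteState m) : (unboundedOp T) ⟨toFock m f, ⟨f, rfl⟩⟩ = toFock m (T f) := by
    have : (LinearEquiv.ofInjective (toFock m) (toFock_injective m)).symm
        ⟨toFock m f, ⟨f, rfl⟩⟩ = f :=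
      (LinearEquiv.ofInjective (toFock m) (toFock_injective m)).symm_apply_apply f
    exact congrArg (fun f => toFock m (T f)) this
  constructor
  · rintro ⟨⟨_, f, rfl⟩, rfl, rfl⟩
    exact ⟨f, rfl, (h f).symm⟩
  · rintro ⟨f, rfl, rfl⟩
    exact ⟨⟨toFock m f, f, rfl⟩, rfl, h f⟩

/-- The coded states are a core: they are dense in the domain of the closure in the graph norm. -/
theorem exists_codeState_near_of_mem_graph {m : ℕ} {T : Module.End ℂ (FiniteState m)}
    {φ χ : Fock m} (h : (φ, χ) ∈ (unboundedOp T).closure.graph) {ε : ℝ} (hε : 0 < ε) :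
    ∃ c, ‖toFock m (codeState m c) - φ‖ < ε ∧ ‖toFock m (T (codeState m c)) - χ‖ < ε := by
  -- if the operator is not closable, its closure is the operator itself, by convention
  have hcl : (φ, χ) ∈ closure ((unboundedOp T).graph : Set (Fock m × Fock m)) := by
    by_cases hc : (unboundedOp T).IsClosable
    · rw [← hc.graph_closure_eq_closure_graph] at h
      exact h
    · rw [LinearPMap.closure_def' hc] at h
      exact subset_closure h
  obtain ⟨⟨φ', χ'⟩, hmem, hdist⟩ := Metric.mem_closure_iff.1 hcl _ (half_pos hε)
  obtain ⟨f, rfl, rfl⟩ := mem_graph_unboundedOp.1 hmem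
  obtain ⟨c, h1, h2⟩ := exists_codeState_near T f (half_pos hε)
  rw [Prod.dist_eq, max_lt_iff, dist_eq_norm, dist_eq_norm] at hdist
  rw [norm_sub_rev, norm_sub_rev χ] at hdist
  refine ⟨c, ?_, ?_⟩
  · linarith [norm_sub_le_norm_sub_add_norm_sub (toFock m (codeState m c)) (toFock m f) φ]
  · linarith [norm_sub_le_norm_sub_add_norm_sub (toFock m (T (codeState m c))) (toFock m (T f)) χ]

theorem real_smul_eq {m : ℕ} (s : ℝ) (φ : Fock m) : s • φ = (s : ℂ) • φ := by
  ext n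
  simp only [lp.coeFn_smul, Pi.smul_apply]
  exact (Complex.coe_smul s (φ n)).symm

/-! ### Approximation of the time evolution -/

namespace IsPropagator

variable {m : ℕ} {T : Module.End ℂ (FiniteState m)} {U : ℝ → (Fock m ≃ₗᵢ[ℂ] Fock m)}

theorem mem_closure_graph (f : FiniteState m) :
    (toFock m f, toFock m (T f)) ∈ (unboundedOp T).closure.graph :=
  LinearPMap.le_graph_of_le (LinearPMap.le_closure _) (mem_graph_unboundedOp.2 ⟨f, rfl, rfl⟩)

theorem hasDerivAt_zero (hU : IsPropagator (unboundedOp T) U) (f : FiniteState m) :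
    HasDerivAt (fun t => U t (toFock m f)) (-I • toFock m (T f)) 0 := by
  rw [hU.generator, smul_smul, mul_neg, Complex.I_mul_I, neg_neg, one_smul]
  exact mem_closure_graph f

theorem hasDerivAt {H : Fock m →ₗ.[ℂ] Fock m} (hU : IsPropagator H U) {φ χ : Fock m}
    (h : HasDerivAt (fun t => U t φ) χ 0) (s : ℝ) : HasDerivAt (fun t => U t φ) (U s χ) s := by
  have h1 : HasDerivAt (fun t => U (t - s) φ) χ s := by
    have h' : HasDerivAt (fun t => U t φ) χ (s - s) := by rwa [sub_self]
    have h'' := HasDerivAt.scomp (h := fun t => t - s) s h' ((hasDerivAt_id s).sub_const s)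
    rw [one_smul] at h''
    exact h''
  have h2 := ((U s).toContinuousLinearEquiv.toContinuousLinearMap.restrictScalars
    ℝ).hasFDerivAt.comp_hasDerivAt s h1
  refine h2.congr_of_eventuallyEq (Filter.Eventually.of_forall fun t => ?_)
  change U t φ = U s (U (t - s) φ)
  rw [← hU.map_add, add_sub_cancel]

/-- The evolution preserves the domain of the generator and commutes with it. -/
theorem apply_mem_closure_graph (hU : IsPropagator (unboundedOp T) U) (f : FiniteState m)
    (s : ℝ) : (U s (toFock m f), U s (toFock m (T f))) ∈ (unboundedOp T).closure.graph := by
  have h := hU.hasDerivAt (hU.hasDerivAt_zero f) s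
  have h1 : HasDerivAt (fun t => U t (U s (toFock m f))) (U s (-I • toFock m (T f))) 0 := by
    have h' : HasDerivAt (fun t => U t (toFock m f)) (U s (-I • toFock m (T f))) (0 + s) := by
      rwa [zero_add]
    have h2 := h'.scomp (0 : ℝ) ((hasDerivAt_id (0 : ℝ)).add_const s)
    simp only [one_smul] at h2
    refine h2.congr_of_eventuallyEq (Filter.Eventually.of_forall fun t => ?_)
    exact (hU.map_add t s _).symm
  rw [hU.generator, map_smul, smul_smul, mul_neg, Complex.I_mul_I, neg_neg, one_smul] at h1
  exact h1

/-- If the velocity of the segment from `f` to `g` differs little from `-iτT`, applied to the two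
end points, then the evolution for the time `τ` takes `f` almost to `g`. -/
theorem norm_apply_sub_le (hU : IsPropagator (unboundedOp T) U) (τ : ℝ) {δ : ℝ}
    {f g : FiniteState m} (hf : ‖toFock m (g - f + (I * τ) • T f)‖ ≤ δ)
    (hg : ‖toFock m (g - f + (I * τ) • T g)‖ ≤ δ) :
    ‖U τ (toFock m f) - toFock m g‖ ≤ δ := by
  -- the path `s ↦ U ((1 - s) τ) (f + s (g - f))` leads from `U τ f` to `g`
  let γ : ℝ → Fock m := fun s =>
    U ((1 - s) * τ) (toFock m f) + s • U ((1 - s) * τ) (toFock m (g - f))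
  have hcomp (φ : FiniteState m) (s : ℝ) :
      HasDerivAt (fun s => U ((1 - s) * τ) (toFock m φ))
        (U ((1 - s) * τ) ((I * τ) • toFock m (T φ))) s := by
    have h1 : HasDerivAt (fun s : ℝ => (1 - s) * τ) (-τ) s := by
      simpa using ((hasDerivAt_id s).const_sub 1).mul_const τ
    have h2 := (hU.hasDerivAt (hU.hasDerivAt_zero φ) ((1 - s) * τ)).scomp s h1
    refine h2.congr_deriv ?_
    rw [real_smul_eq, ← map_smul, smul_smul]
    congr 2
    push_cast
    ring
  have hγ (s : ℝ) : HasDerivAt γ (U ((1 - s) * τ) ((I * τ) • toFock m (T f)) +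
      (s • U ((1 - s) * τ) ((I * τ) • toFock m (T (g - f))) +
        (1 : ℝ) • U ((1 - s) * τ) (toFock m (g - f)))) s :=
    (hcomp f s).add ((hasDerivAt_id s).smul (hcomp (g - f) s))
  have hbound (s : ℝ) (hs : s ∈ Set.Ico (0 : ℝ) 1) :
      ‖U ((1 - s) * τ) ((I * τ) • toFock m (T f)) +
        (s • U ((1 - s) * τ) ((I * τ) • toFock m (T (g - f))) +
          (1 : ℝ) • U ((1 - s) * τ) (toFock m (g - f)))‖ ≤ δ := by
    have h : U ((1 - s) * τ) ((I * τ) • toFock m (T f)) +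
        (s • U ((1 - s) * τ) ((I * τ) • toFock m (T (g - f))) +
          (1 : ℝ) • U ((1 - s) * τ) (toFock m (g - f))) =
        U ((1 - s) * τ) (((1 - s : ℝ) : ℂ) • toFock m (g - f + (I * τ) • T f) +
          ((s : ℝ) : ℂ) • toFock m (g - f + (I * τ) • T g)) := by
      rw [_root_.map_add (U _), map_smul (U _), map_smul (U _)]
      simp only [map_sub, _root_.map_add, map_smul, real_smul_eq]
      push_cast
      module
    rw [h, LinearIsometryEquiv.norm_map]
    refine (norm_add_le _ _).trans ?_
    rw [norm_smul, norm_smul, Complex.norm_real, Complex.norm_real, Real.norm_eq_abs,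
      Real.norm_eq_abs, abs_of_nonneg hs.1, abs_of_nonneg (by linarith [hs.2])]
    have hs0 := hs.1
    have hs1 : 0 ≤ 1 - s := by linarith [hs.2]
    calc _ ≤ (1 - s) * δ + s * δ := by gcongr
      _ = δ := by ring
  have hmv := norm_image_sub_le_of_norm_deriv_le_segment_01'
    (fun s _ => (hγ s).hasDerivWithinAt) hbound
  have h1 : γ 1 = toFock m g := by
    simp only [γ, sub_self, zero_mul, hU.map_zero, one_smul, map_sub]
    abel
  have h0 : γ 0 = U τ (toFock m f) := by simp [γ]
  rw [h1, h0] at hmv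
  rwa [norm_sub_rev]

/-- The defect at `f` of the velocity of the segment from `c` to `c'`, run through in the time
`t / K`. -/
def defect (T : Module.End ℂ (FiniteState m)) (t : ℝ) (K : ℕ) (c c' : StateCode)
    (f : FiniteState m) : ℝ :=
  ‖toFock m ((K : ℂ) • (codeState m c' - codeState m c) + (I * t) • T f)‖

/-- The defects bound the distance between the end point of a polygon and the exact evolution of its
starting point, because the errors of the segments add up. -/
theorem norm_apply_sub_le_of_isChain (hU : IsPropagator (unboundedOp T) U) {t δ : ℝ} {K : ℕ}
    (hK : K ≠ 0) {c : StateCode} {l : List StateCode}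
    (hl : (c :: l).IsChain fun c c' => defect T t K c c' (codeState m c) ≤ δ ∧
      defect T t K c c' (codeState m c') ≤ δ) :
    ‖U (l.length * t / K) (toFock m (codeState m c)) - toFock m (codeState m (l.getLastD c))‖ ≤
      l.length * (δ / K) := by
  have hK' : (K : ℝ) ≠ 0 := Nat.cast_ne_zero.2 hK
  have hKc : (K : ℂ) ≠ 0 := Nat.cast_ne_zero.2 hK
  induction l generalizing c with
  | nil => simp [hU.map_zero]
  | cons c' l ih =>
    rw [List.isChain_cons_cons] at hl
    have hscale (f : FiniteState m) (h : defect T t K c c' f ≤ δ) :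
        ‖toFock m (codeState m c' - codeState m c + (I * ((t / K : ℝ) : ℂ)) • T f)‖ ≤ δ / K := by
      have : codeState m c' - codeState m c + (I * ((t / K : ℝ) : ℂ)) • T f =
          (K : ℂ)⁻¹ • ((K : ℂ) • (codeState m c' - codeState m c) + (I * t) • T f) := by
        rw [smul_add, smul_smul, smul_smul, inv_mul_cancel₀ hKc, one_smul]
        congr 2
        push_cast
        field_simp
      rw [this, map_smul, norm_smul, norm_inv, Complex.norm_natCast, inv_mul_eq_div]
      exact div_le_div_of_nonneg_right h (Nat.cast_nonneg _)
    have h1 := hU.norm_apply_sub_le (t / K) (hscale _ hl.1.1) (hscale _ hl.1.2)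
    have h2 := ih hl.2
    have hsplit : ((c' :: l).length : ℝ) * t / K = l.length * t / K + t / K := by
      rw [List.length_cons]
      push_cast
      ring
    rw [hsplit, hU.map_add, List.getLastD_cons]
    refine (norm_sub_le_norm_sub_add_norm_sub _
      (U (l.length * t / K) (toFock m (codeState m c'))) _).trans ?_
    rw [← map_sub, LinearIsometryEquiv.norm_map, List.length_cons]
    push_cast
    linarith

/-- Every orbit of a coded state is followed by chains of coded states with arbitrarily small
defects. -/
theorem exists_isChain (hU : IsPropagator (unboundedOp T) U) (t : ℝ) (c : StateCode) {δ : ℝ}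
    (hδ : 0 < δ) :
    ∃ l : List StateCode, l ≠ [] ∧ (c :: l).IsChain fun c c' =>
      defect T t l.length c c' (codeState m c) < δ ∧
        defect T t l.length c c' (codeState m c') < δ := by
  set ψ := toFock m (codeState m c)
  set χ := toFock m (T (codeState m c))
  have hderiv : HasDerivAt (fun s : ℝ => U (s * t) ψ) (-(I * t) • χ) 0 := by
    have h1 : HasDerivAt (fun s : ℝ => s * t) t 0 := by
      simpa using (hasDerivAt_id (0 : ℝ)).mul_const t
    have h0 : HasDerivAt (fun t => U t ψ) (-I • χ) (0 * t) := by
      rw [zero_mul]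
      exact hU.hasDerivAt_zero _
    have h2 := h0.scomp (0 : ℝ) h1
    refine h2.congr_deriv ?_
    rw [real_smul_eq, smul_smul]
    congr 1
    ring
  -- The difference quotients of the orbit at the time `0` are needed for positive increments, where
  -- they compare the chord with the velocity at its start, and for negative ones, where they
  -- compare it with the velocity at its end. The unitary group carries both estimates to all
  -- other times.
  rw [hasDerivAt_iff_tendsto_slope_zero] at hderiv
  have hlim : Filter.Tendsto (fun n : ℕ => 1 / ((n : ℝ) + 1)) Filter.atTop
      (nhdsWithin 0 {0}ᶜ) :=
    tendsto_nhdsWithin_iff.2 ⟨tendsto_one_div_add_atTop_nhds_zero_nat,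
      Filter.Eventually.of_forall fun n => by
        have : (0 : ℝ) < 1 / (n + 1) := Nat.one_div_pos_of_nat
        exact this.ne'⟩
  have hlim' : Filter.Tendsto (fun n : ℕ => -(1 / ((n : ℝ) + 1))) Filter.atTop
      (nhdsWithin 0 {0}ᶜ) := by
    refine tendsto_nhdsWithin_iff.2 ⟨by
        simpa using (tendsto_one_div_add_atTop_nhds_zero_nat (𝕜 := ℝ)).neg,
      Filter.Eventually.of_forall fun n => ?_⟩
    have : (0 : ℝ) < 1 / (n + 1) := Nat.one_div_pos_of_nat
    exact (neg_neg_of_pos this).ne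
  obtain ⟨n, hn1, hn2⟩ := (((Metric.tendsto_nhds.1 (hderiv.comp hlim)) _ (half_pos hδ)).and
    ((Metric.tendsto_nhds.1 (hderiv.comp hlim')) _ (half_pos hδ))).exists
  set K : ℕ := n + 1
  have hK : (0 : ℝ) < K := Nat.cast_pos.2 n.succ_pos
  have hn1 : ‖(K : ℂ) • (U (t / K) ψ - ψ) + (I * t) • χ‖ < δ / 2 := by
    have h1 : (((1 / ((n : ℝ) + 1))⁻¹ : ℝ) : ℂ) = K := by simp [K]
    have h2 : 1 / ((n : ℝ) + 1) * t = t / K := by simp only [K]; push_cast; ring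
    rw [dist_eq_norm, Function.comp_apply, zero_add, zero_mul, hU.map_zero, real_smul_eq, neg_smul,
      sub_neg_eq_add, h1, h2] at hn1
    exact hn1
  have hn2 : ‖(K : ℂ) • (ψ - U (-(t / K)) ψ) + (I * t) • χ‖ < δ / 2 := by
    have h1 : (((-(1 / ((n : ℝ) + 1)))⁻¹ : ℝ) : ℂ) = -K := by simp [K, inv_neg]
    have h2 : -(1 / ((n : ℝ) + 1)) * t = -(t / K) := by simp only [K]; push_cast; ring
    rw [dist_eq_norm, Function.comp_apply, zero_add, zero_mul, hU.map_zero, real_smul_eq, neg_smul,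
      sub_neg_eq_add, h1, h2, neg_smul, ← smul_neg, neg_sub] at hn2
    exact hn2
  set η : ℝ := δ / (2 * (2 * K + |t| + 1))
  have hden : 0 < 2 * (2 * (K : ℝ) + |t| + 1) := by positivity
  have hη : 0 < η := div_pos hδ hden
  have hηδ : (2 * K + |t|) * η < δ / 2 := by
    have : η * (2 * (2 * K + |t| + 1)) = δ := div_mul_cancel₀ _ hden.ne'
    nlinarith
  -- The vertices of the polygon approximate the orbit at the multiples of `t / K`, in the graph
  -- norm. The approximation is so good that multiplication of the errors by `K` does no harm.
  have happrox (j : ℕ) : ∃ c' : StateCode, (j = 0 → c' = c) ∧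
      ‖toFock m (codeState m c') - U (j * (t / K)) ψ‖ ≤ η ∧
      ‖toFock m (T (codeState m c')) - U (j * (t / K)) χ‖ ≤ η := by
    rcases j with _ | j
    · refine ⟨c, fun _ => rfl, ?_, ?_⟩ <;> simp [hU.map_zero, ψ, χ, hη.le]
    · obtain ⟨c', h1, h2⟩ := exists_codeState_near_of_mem_graph
        (hU.apply_mem_closure_graph (codeState m c) ((j + 1 : ℕ) * (t / K))) hη
      exact ⟨c', fun h => absurd h j.succ_ne_zero, h1.le, h2.le⟩
  choose a ha0 ha1 ha2 using happrox
  have hstep (j : ℕ) (i : ℕ) (hi : ‖(K : ℂ) • (U ((j + 1 : ℕ) * (t / K)) ψ - U (j * (t / K)) ψ) +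
      (I * t) • U (i * (t / K)) χ‖ < δ / 2) :
      defect T t K (a j) (a (j + 1)) (codeState m (a i)) < δ := by
    rw [defect]
    simp only [_root_.map_add, map_smul, map_sub]
    have h : (K : ℂ) • (toFock m (codeState m (a (j + 1))) - toFock m (codeState m (a j))) +
        (I * t) • toFock m (T (codeState m (a i))) =
        ((K : ℂ) • (U ((j + 1 : ℕ) * (t / K)) ψ - U (j * (t / K)) ψ) +
          (I * t) • U (i * (t / K)) χ) +
        ((K : ℂ) • (toFock m (codeState m (a (j + 1))) - U ((j + 1 : ℕ) * (t / K)) ψ) +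
        (-(K : ℂ) • (toFock m (codeState m (a j)) - U (j * (t / K)) ψ) +
        (I * t) • (toFock m (T (codeState m (a i))) - U (i * (t / K)) χ))) := by
      module
    rw [h]
    refine (norm_add_le _ _).trans_lt ?_
    have h1 := ha1 j
    have h2 := ha1 (j + 1)
    have h3 := ha2 i
    have hrest : ‖(K : ℂ) • (toFock m (codeState m (a (j + 1))) - U ((j + 1 : ℕ) * (t / K)) ψ) +
        (-(K : ℂ) • (toFock m (codeState m (a j)) - U (j * (t / K)) ψ) +
        (I * t) • (toFock m (T (codeState m (a i))) - U (i * (t / K)) χ))‖ ≤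
        K * η + (K * η + |t| * η) := by
      refine (norm_add_le _ _).trans (add_le_add ?_ ((norm_add_le _ _).trans (add_le_add ?_ ?_)))
      · rw [norm_smul, Complex.norm_natCast]
        gcongr
      · rw [norm_smul, norm_neg, Complex.norm_natCast]
        gcongr
      · rw [norm_smul, norm_mul, Complex.norm_I, one_mul, Complex.norm_real, Real.norm_eq_abs]
        gcongr
    linarith
  refine ⟨(List.range K).map fun j => a (j + 1), by simp [K], ?_⟩
  have hcons : c :: (List.range K).map (fun j => a (j + 1)) = (List.range (K + 1)).map a := by
    rw [List.range_succ_eq_map (n := K), List.map_cons, List.map_map, ha0 0 rfl]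
    rfl
  rw [hcons, List.length_map, List.length_range, List.isChain_map, List.isChain_range_succ]
  intro j _
  have hadd : ((j + 1 : ℕ) : ℝ) * (t / K) = j * (t / K) + t / K := by push_cast; ring
  refine ⟨hstep j j ?_, hstep j (j + 1) ?_⟩
  · rw [hadd, hU.map_add, ← map_sub, ← map_smul, ← map_smul, ← _root_.map_add,
      LinearIsometryEquiv.norm_map]
    exact hn1
  · have hj : (j : ℝ) * (t / K) = (j + 1 : ℕ) * (t / K) + -(t / K) := by rw [hadd]; ring
    rw [hj, hU.map_add, ← map_sub, ← map_smul, ← map_smul, ← _root_.map_add,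
      LinearIsometryEquiv.norm_map]
    exact hn2

end IsPropagator

/-! ### The verification algorithm -/

/-- A bit string as a signed number `i ^ q * n`. -/
def readSigned : List Bool → ℕ × ℕ
  | [] => (0, 0)
  | s :: l => (if s then 2 else 0, l.foldr Nat.bit 0)

/-- The coefficients of a polynomial: exponents, real parts and imaginary parts, the last two as
signed numbers. -/
abbrev CoefficientList : Type := List (List ℕ × (ℕ × ℕ) × (ℕ × ℕ))

/-- The list of the exponents of a monomial in the quadratures of `k` modes, with its length
normalized. -/
def exponents (k : ℕ) (e : List ℕ) : List ℕ := (List.range (k + k)).map fun j => e.getD j 0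

/-- The first coefficient listed for the given monomial, and zero if there is none. -/
def findCoefficient (k : ℕ) (l : CoefficientList) (e : List ℕ) : (ℕ × ℕ) × (ℕ × ℕ) :=
  l.foldr (fun a v => if exponents k a.1 = e then a.2 else v) ((0, 0), (0, 0))

/-- The word of a monomial in the quadratures of the modes listed in `σ`. -/
def monomialWord (k m : ℕ) (σ e : List ℕ) : List ℕ :=
  ((List.range k).flatMap fun j => List.replicate (e.getD j 0) (σ.getD j 0)) ++
    (List.range k).flatMap fun j => List.replicate (e.getD (k + j) 0) (m + σ.getD j 0)

/-- A summand of a Hamiltonian: `(q, n, w)` stands for `i ^ q * n / 2 ^ r` times the product of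
quadratures `w`. -/
abbrev Summand : Type := ℕ × ℕ × List ℕ

/-- A gate: the time as a signed number, and the summands of the Hamiltonian. -/
abbrev Instruction : Type := (ℕ × ℕ) × List Summand

/-- The monomials listed, without repetitions. -/
def distinctMonomials (k : ℕ) (l : CoefficientList) : List (List ℕ) :=
  (l.map fun a => exponents k a.1).foldr List.insert []

/-- The summands of a polynomial. The monomials are those of the first list, and the coefficients
are taken from the second one. -/
def polynomialSummands (k m : ℕ) (σ : List ℕ) (l l' : CoefficientList) : List Summand :=
  (distinctMonomials k l).flatMap fun e =>
    [((findCoefficient k l' e).1.1, (findCoefficient k l' e).1.2, monomialWord k m σ e),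
      ((findCoefficient k l' e).2.1 + 1, (findCoefficient k l' e).2.2, monomialWord k m σ e)]

/-- The summands of a quadratic Hamiltonian, the parameters of which are listed in `z`, starting
with the evolution time. -/
def quadraticSummands (m : ℕ) (z : List (ℕ × ℕ)) : List Summand :=
  ((z.getD 1 (0, 0)).1, (z.getD 1 (0, 0)).2, []) ::
    (((List.range (m + m)).map fun u =>
      ((z.getD (2 + u) (0, 0)).1, (z.getD (2 + u) (0, 0)).2, [u])) ++
    (List.range (m + m)).flatMap fun u => (List.range (m + m)).map fun v =>
      ((z.getD (2 + (m + m) + ((m + m) * u + v)) (0, 0)).1,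
        (z.getD (2 + (m + m) + ((m + m) * u + v)) (0, 0)).2, [u, v]))

/-- The instruction described by a row. The table `T` contains for each Hamiltonian of the gate set
two lists of coefficients. -/
def instruction (k m : ℕ) (T : List (CoefficientList × CoefficientList)) (z : List (ℕ × ℕ)) :
    Instruction :=
  if (z.getD 0 (0, 0)).2 = 0 then
    (z.getD (2 + k) (0, 0),
      polynomialSummands k m ((List.range k).map fun j => (z.getD (2 + j) (0, 0)).2)
        (T.getD (z.getD 1 (0, 0)).2 ([], [])).1 (T.getD (z.getD 1 (0, 0)).2 ([], [])).2)
  else (z.getD 1 (0, 0), quadraticSummands m z.tail)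

/-- The action of `i t H` on a code, where `t` and `H` are given with precision `r`. -/
def generatorAct (m r : ℕ) (ι : Instruction) (c : StateCode) : StateCode :=
  ι.2.flatMap fun e =>
    scaleCode (ι.1.1 + e.1 + 1) (ι.1.2 * e.2.1) (r + r) (wordAct m e.2.2 c)

/-- A bound for `4 ^ r` times the error of `generatorAct`. -/
def errorBound (m : ℕ) (ι : Instruction) (c : StateCode) : ℕ :=
  (ι.2.map fun e => (ι.1.2 + e.2.1 + 1) * normBound m (wordAct m e.2.2 c)).sum

/-- The test that the segment from `c` to `c'`, run through in the `K`-th part of the time of the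
gate, solves the Schrödinger equation at `x` up to an error of the order `2 ^ (-s)`. -/
def DefectTest (m r s : ℕ) (ι : Instruction) (K : ℕ) (c c' x : StateCode) : Prop :=
  NormLE m s (scaleCode 0 K 0 c' ++ (scaleCode 2 K 0 c ++ generatorAct m r ι x)) ∧
    errorBound m ι x * 2 ^ s ≤ 4 ^ r

instance (m r s : ℕ) (ι : Instruction) (K : ℕ) (c c' x : StateCode) :
    Decidable (DefectTest m r s ι K c c' x) := by
  unfold DefectTest; infer_instance

/-- The defect test at both ends of the segment. -/
def SegmentTest (m r s : ℕ) (ι : Instruction) (K : ℕ) (c c' : StateCode) : Prop :=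
  DefectTest m r s ι K c c' c ∧ DefectTest m r s ι K c c' c'

instance (m r s : ℕ) (ι : Instruction) (K : ℕ) (c c' : StateCode) :
    Decidable (SegmentTest m r s ι K c c') := by
  unfold SegmentTest; infer_instance

/-- Tests a proposed polygon for one gate. The pair consists of the result of all tests so far, and
of the current state. -/
def gateTest (m r s : ℕ) (ι : Instruction) (p : Bool × StateCode) (l : List StateCode) :
    Bool × StateCode :=
  l.foldl (fun p c' => (p.1 && decide (SegmentTest m r s ι l.length p.2 c'), c'))
    (p.1 && decide (¬l.length = 0), p.2)

/-- Tests proposed polygons for all gates, one after the other. -/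
def circuitTest (k m r s : ℕ) (T : List (CoefficientList × CoefficientList))
    (rows : List (List (ℕ × ℕ))) (p : (Bool × StateCode) × List (List StateCode)) :
    (Bool × StateCode) × List (List StateCode) :=
  rows.foldl (fun p z => (gateTest m r s (instruction k m T z) p.1 (p.2.getD 0 []), p.2.tail)) p

/-- The part of a state in which the number of photons in the first mode lies between `a` and
`b`. -/
def restrictCode (a b : ℕ) (c : StateCode) : StateCode :=
  c.filter fun t => a ≤ t.2.2.2.getD 0 0 ∧ t.2.2.2.getD 0 0 ≤ b

/-- The test whether the squared norm is greater than `1/2`. -/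
def HalfLT (m : ℕ) (c : StateCode) : Prop :=
  2 * gram m 2 c + 4 ^ denominator c < 2 * gram m 0 c

instance (m : ℕ) (c : StateCode) : Decidable (HalfLT m c) := by unfold HalfLT; infer_instance

/-- Runs all tests, starting from the vacuum, for the description `w` with precision `r`. -/
def verify (k : ℕ) (w : List Token) (T : List (CoefficientList × CoefficientList)) (r : ℕ)
    (L : List (List StateCode)) : Bool × StateCode :=
  (circuitTest k (readSigned (((readTable w).getD 0 []).getD 0 [])).2 r
    ((readTable w).tail.length + 5) T ((readTable w).tail.map fun row => row.map readSigned)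
    ((true, vacuumCode), L)).1

/-- The decision that is based on the final state `c`. -/
def decision (w : List Token) (c : StateCode) : Bool :=
  decide (HalfLT (readSigned (((readTable w).getD 0 []).getD 0 [])).2
    (restrictCode (readSigned (((readTable w).getD 0 []).getD 1 [])).2
      (readSigned (((readTable w).getD 0 []).getD 2 [])).2 c))

/-! ### The algorithm is primitive recursive -/

section Primrec

variable {α : Type*} [Primcodable α]

@[fun_prop] theorem primrec_readSigned {f : α → List Bool} (hf : Primrec f) :
    Primrec fun a => readSigned (f a) := by
  have h : Primrec readSigned := by
    have h1 : Primrec₂ fun (_ : List Bool) (p : Bool × List Bool) =>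
        ((if p.1 = true then 2 else 0 : ℕ), p.2.foldr Nat.bit 0) := by
      unfold Primrec₂; fun_prop
    refine (Primrec.list_casesOn Primrec.id (Primrec.const (0, 0)) h1).of_eq fun l => ?_
    cases l <;> rfl
  exact h.comp hf

theorem primrec_readTable : Primrec readTable := by
  have h1 : Primrec fun T : List (List (List Bool)) => T.headI := Primrec.list_headI
  have h2 : Primrec fun T : List (List Bool) => T.headI := Primrec.list_headI
  have h : Primrec fun w : List Token => w.foldr (fun c T =>
      if c = none then [] :: T
      else if T.length = 0 then T
      else if c = some none then ([] :: T.headI) :: T.tail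
      else if T.headI.length = 0 then T
      else ((decide (c = some (some true)) :: T.headI.headI) :: T.headI.tail) :: T.tail) [] := by
    fun_prop
  refine h.of_eq fun w => ?_
  rw [readTable]
  congr 1
  ext1 c
  ext1 T
  rcases c with _ | _ | b
  · rfl
  · rcases T with _ | ⟨row, T⟩ <;> simp
  · rcases T with _ | ⟨_ | ⟨entry, row⟩, T⟩ <;> simp

@[fun_prop] theorem primrec_exponents {k : ℕ} {f : α → List ℕ} (hf : Primrec f) :
    Primrec fun a => exponents k (f a) := by
  unfold exponents; fun_prop

@[fun_prop] theorem primrec_findCoefficient {k : ℕ} {f : α → CoefficientList} {g : α → List ℕ}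
    (hf : Primrec f) (hg : Primrec g) : Primrec fun a => findCoefficient k (f a) (g a) := by
  unfold findCoefficient; fun_prop

@[fun_prop] theorem primrec_monomialWord {k : ℕ} {f : α → ℕ} {g h : α → List ℕ}
    (hf : Primrec f) (hg : Primrec g) (hh : Primrec h) :
    Primrec fun a => monomialWord k (f a) (g a) (h a) := by
  unfold monomialWord; fun_prop

@[fun_prop] theorem primrec_distinctMonomials {k : ℕ} {f : α → CoefficientList}
    (hf : Primrec f) : Primrec fun a => distinctMonomials k (f a) := by
  have h : Primrec₂ fun (e : List ℕ) (l : List (List ℕ)) => l.insert e := by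
    have hmem : PrimrecRel fun (l : List (List ℕ)) (e : List ℕ) => ∃ e' ∈ l, e' = e :=
      PrimrecRel.exists_mem_list Primrec.eq
    have hmem' : PrimrecPred fun p : List ℕ × List (List ℕ) => ∃ e' ∈ p.2, e' = p.1 :=
      hmem.comp Primrec.snd Primrec.fst
    exact (Primrec.ite hmem' Primrec.snd (Primrec.list_cons.comp Primrec.fst Primrec.snd)).of_eq
      fun p => by simp [List.insert]
  have h' : Primrec fun p : α × List ℕ × List (List ℕ) => p.2.2.insert p.2.1 :=
    h.comp (by fun_prop) (by fun_prop)
  unfold distinctMonomials; fun_prop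

@[fun_prop] theorem primrec_polynomialSummands {k : ℕ} {f : α → ℕ} {g : α → List ℕ}
    {h h' : α → CoefficientList} (hf : Primrec f) (hg : Primrec g) (hh : Primrec h)
    (hh' : Primrec h') : Primrec fun a => polynomialSummands k (f a) (g a) (h a) (h' a) := by
  unfold polynomialSummands; fun_prop

@[fun_prop] theorem primrec_quadraticSummands {f : α → ℕ} {g : α → List (ℕ × ℕ)}
    (hf : Primrec f) (hg : Primrec g) : Primrec fun a => quadraticSummands (f a) (g a) := by
  unfold quadraticSummands; fun_prop

@[fun_prop] theorem primrec_instruction {k : ℕ} {f : α → ℕ}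
    {g : α → List (CoefficientList × CoefficientList)} {h : α → List (ℕ × ℕ)}
    (hf : Primrec f) (hg : Primrec g) (hh : Primrec h) :
    Primrec fun a => instruction k (f a) (g a) (h a) := by
  unfold instruction; fun_prop

@[fun_prop] theorem primrec_scaleCode {f g h : α → ℕ} {c : α → StateCode} (hf : Primrec f)
    (hg : Primrec g) (hh : Primrec h) (hc : Primrec c) :
    Primrec fun a => scaleCode (f a) (g a) (h a) (c a) := by
  unfold scaleCode; fun_prop

@[fun_prop] theorem primrec_setOccupation {f g h : α → ℕ} {κ : α → List ℕ} (hf : Primrec f)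
    (hg : Primrec g) (hh : Primrec h) (hκ : Primrec κ) :
    Primrec fun a => setOccupation (f a) (κ a) (g a) (h a) := by
  unfold setOccupation; fun_prop

@[fun_prop] theorem primrec_letterAct {f g : α → ℕ} {t : α → StateTerm} (hf : Primrec f)
    (hg : Primrec g) (ht : Primrec t) : Primrec fun a => letterAct (f a) (g a) (t a) := by
  unfold letterAct; fun_prop

@[fun_prop] theorem primrec_wordAct {f : α → ℕ} {g : α → List ℕ} {c : α → StateCode}
    (hf : Primrec f) (hg : Primrec g) (hc : Primrec c) :
    Primrec fun a => wordAct (f a) (g a) (c a) := by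
  unfold wordAct; fun_prop

@[fun_prop] theorem primrec_overlap {f : α → ℕ} {g h : α → List ℕ} (hf : Primrec f)
    (hg : Primrec g) (hh : Primrec h) : Primrec fun a => overlap (f a) (g a) (h a) := by
  unfold overlap; fun_prop

@[fun_prop] theorem primrec_denominator {c : α → StateCode} (hc : Primrec c) :
    Primrec fun a => denominator (c a) := by
  unfold denominator; fun_prop

@[fun_prop] theorem primrec_gram {f g : α → ℕ} {c : α → StateCode} (hf : Primrec f)
    (hg : Primrec g) (hc : Primrec c) : Primrec fun a => gram (f a) (g a) (c a) := by
  unfold gram; fun_prop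

@[fun_prop] theorem primrecPred_normLE {f g : α → ℕ} {c : α → StateCode} (hf : Primrec f)
    (hg : Primrec g) (hc : Primrec c) : PrimrecPred fun a => NormLE (f a) (g a) (c a) := by
  unfold NormLE; fun_prop

@[fun_prop] theorem primrec_normBound {f : α → ℕ} {c : α → StateCode} (hf : Primrec f)
    (hc : Primrec c) : Primrec fun a => normBound (f a) (c a) := by
  unfold normBound; fun_prop

@[fun_prop] theorem primrec_generatorAct {f g : α → ℕ} {h : α → Instruction} {c : α → StateCode}
    (hf : Primrec f) (hg : Primrec g) (hh : Primrec h) (hc : Primrec c) :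
    Primrec fun a => generatorAct (f a) (g a) (h a) (c a) := by
  unfold generatorAct; fun_prop

@[fun_prop] theorem primrec_errorBound {f : α → ℕ} {h : α → Instruction} {c : α → StateCode}
    (hf : Primrec f) (hh : Primrec h) (hc : Primrec c) :
    Primrec fun a => errorBound (f a) (h a) (c a) := by
  unfold errorBound; fun_prop

@[fun_prop] theorem primrecPred_defectTest {f g h K : α → ℕ} {ι : α → Instruction}
    {c c' x : α → StateCode} (hf : Primrec f) (hg : Primrec g) (hh : Primrec h)
    (hι : Primrec ι) (hK : Primrec K) (hc : Primrec c) (hc' : Primrec c') (hx : Primrec x) :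
    PrimrecPred fun a => DefectTest (f a) (g a) (h a) (ι a) (K a) (c a) (c' a) (x a) := by
  unfold DefectTest; fun_prop

@[fun_prop] theorem primrecPred_segmentTest {f g h K : α → ℕ} {ι : α → Instruction}
    {c c' : α → StateCode} (hf : Primrec f) (hg : Primrec g) (hh : Primrec h)
    (hι : Primrec ι) (hK : Primrec K) (hc : Primrec c) (hc' : Primrec c') :
    PrimrecPred fun a => SegmentTest (f a) (g a) (h a) (ι a) (K a) (c a) (c' a) := by
  unfold SegmentTest; fun_prop

@[fun_prop] theorem primrec_gateTest {f g h : α → ℕ} {ι : α → Instruction}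
    {p : α → Bool × StateCode} {l : α → List StateCode} (hf : Primrec f) (hg : Primrec g)
    (hh : Primrec h) (hι : Primrec ι) (hp : Primrec p) (hl : Primrec l) :
    Primrec fun a => gateTest (f a) (g a) (h a) (ι a) (p a) (l a) := by
  unfold gateTest; fun_prop

@[fun_prop] theorem primrec_circuitTest {k : ℕ} {f g h : α → ℕ}
    {T : α → List (CoefficientList × CoefficientList)} {rows : α → List (List (ℕ × ℕ))}
    {p : α → (Bool × StateCode) × List (List StateCode)} (hf : Primrec f) (hg : Primrec g)
    (hh : Primrec h) (hT : Primrec T) (hrows : Primrec rows) (hp : Primrec p) :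
    Primrec fun a => circuitTest k (f a) (g a) (h a) (T a) (rows a) (p a) := by
  unfold circuitTest; fun_prop

@[fun_prop] theorem primrec_verify {k : ℕ} {w : α → List Token}
    {T : α → List (CoefficientList × CoefficientList)} {r : α → ℕ}
    {L : α → List (List StateCode)} (hw : Primrec w) (hT : Primrec T) (hr : Primrec r)
    (hL : Primrec L) : Primrec fun a => verify k (w a) (T a) (r a) (L a) := by
  have := primrec_readTable
  unfold verify; fun_prop

@[fun_prop] theorem primrec_decision {w : α → List Token} {c : α → StateCode} (hw : Primrec w)
    (hc : Primrec c) : Primrec fun a => decision (w a) (c a) := by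
  have := primrec_readTable
  unfold decision HalfLT restrictCode; fun_prop

end Primrec

/-! ### Reading descriptions of gates -/

theorem dyadic_readSigned (l : List Bool) (d : ℕ) :
    dyadic (readSigned l).1 (readSigned l).2 d = (readInt l : ℂ) / 2 ^ d := by
  rcases l with _ | ⟨s, l⟩
  · simp [readSigned, readInt, dyadic]
  · cases s <;> simp [readSigned, readInt, dyadic]

theorem readSigned_snd (l : List Bool) : (readSigned l).2 = (readInt l).natAbs := by
  rcases l with _ | ⟨s, l⟩
  · rfl
  · cases s <;> simp [readSigned, readInt]

theorem getD_map_readSigned (row : List (List Bool)) (j : ℕ) :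
    (row.map readSigned).getD j (0, 0) = readSigned (row.getD j []) :=
  (List.getD_map (f := readSigned) (d := []) ..)

theorem getD_map_readInt (row : List (List Bool)) (j : ℕ) :
    (row.map readInt).getD j 0 = readInt (row.getD j []) :=
  (List.getD_map (f := readInt) (d := []) ..)

theorem dyadic_getD (row : List (List Bool)) (j d : ℕ) :
    dyadic ((row.map readSigned).getD j (0, 0)).1 ((row.map readSigned).getD j (0, 0)).2 d =
      ((row.map readInt).getD j 0 : ℂ) / 2 ^ d := by
  rw [getD_map_readSigned, getD_map_readInt, dyadic_readSigned]

theorem getD_snd (row : List (List Bool)) (j : ℕ) :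
    ((row.map readSigned).getD j (0, 0)).2 = ((row.map readInt).getD j 0).natAbs := by
  rw [getD_map_readSigned, getD_map_readInt, readSigned_snd]

theorem IsRounding.norm_sub_le {r : ℕ} {z : ℤ} {y : ℝ} (h : IsRounding r z y) :
    ‖(y : ℂ) - (z : ℂ) / 2 ^ r‖ ≤ 1 / 2 ^ r := by
  have : (y : ℂ) - (z : ℂ) / 2 ^ r = ((y - (z : ℝ) / 2 ^ r : ℝ) : ℂ) := by push_cast; rfl
  rw [this, Complex.norm_real]
  exact h

theorem getD_of_forall₂ {r : ℕ} {zs : List ℤ} {ys : List ℝ}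
    (h : List.Forall₂ (IsRounding r) zs ys) (j : ℕ) :
    IsRounding r (zs.getD j 0) (ys.getD j 0) := by
  induction h generalizing j with
  | nil => simp [IsRounding]
  | cons h _ ih =>
    cases j with
    | zero => simpa using h
    | succ j => simpa using ih j

/-! ### Hamiltonians as sums of words -/

/-- The operator `∑ γ • w` for a list of pairs of coefficients `γ` and words `w`. -/
def hamiltonianOp (m : ℕ) (Γ : List (ℂ × List ℕ)) : Module.End ℂ (FiniteState m) :=
  (Γ.map fun g => g.1 • wordOp m g.2).sum

/-- The instruction gives the time `t` and the coefficients of the Hamiltonian with precision `r`,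
and it has the same words. -/
def Matches (r : ℕ) (ι : Instruction) (t : ℝ) (Γ : List (ℂ × List ℕ)) : Prop :=
  ‖(t : ℂ) - dyadic ι.1.1 ι.1.2 r‖ ≤ 1 / 2 ^ r ∧
    List.Forall₂ (fun e g => e.2.2 = g.2 ∧ ‖g.1 - dyadic e.1 e.2.1 r‖ ≤ 1 / 2 ^ r) ι.2 Γ

theorem sum_map_flatMap {α β M : Type*} [AddCommMonoid M] (l : List α) (f : α → List β)
    (g : β → M) : ((l.flatMap f).map g).sum = (l.map fun a => ((f a).map g).sum).sum := by
  induction l with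
  | nil => rfl
  | cons a l ih => simp [ih]

theorem prod_map_flatMap {α β M : Type*} [Monoid M] (l : List α) (f : α → List β)
    (g : β → M) : ((l.flatMap f).map g).prod = (l.map fun a => ((f a).map g).prod).prod := by
  induction l with
  | nil => rfl
  | cons a l ih => simp [ih]

theorem prod_map_range {M : Type*} [Monoid M] (n : ℕ) (f : ℕ → M) :
    ((List.range n).map f).prod = (List.ofFn fun j : Fin n => f j).prod := by
  rw [← List.map_coe_finRange_eq_range, List.map_map, List.ofFn_eq_map]
  rfl

theorem letterOp_eq_position {m : ℕ} (j : Fin m) : letterOp m j = position j := by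
  have h : (j : ℕ) < m + m := by omega
  rw [letterOp, dif_pos h, quadrature, ← Fin.append_left position momentum]
  rfl

theorem letterOp_eq_momentum {m : ℕ} (j : Fin m) : letterOp m (m + j) = momentum j := by
  have h : m + (j : ℕ) < m + m := by omega
  rw [letterOp, dif_pos h, quadrature, ← Fin.append_right position momentum]
  rfl

theorem letterOp_eq_quadrature {m : ℕ} (u : Fin (m + m)) : letterOp m u = quadrature u := by
  rw [letterOp, dif_pos u.2]

theorem wordOp_monomialWord {k m : ℕ} (σ : Fin k → Fin m) (l e : List ℕ)
    (hl : ∀ j : Fin k, l.getD j 0 = σ j) :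
    wordOp m (monomialWord k m l e) =
      (List.ofFn fun j =>
        position (σ j) ^ (monomialOfList e : (Fin k ⊕ Fin k) →₀ ℕ) (Sum.inl j)).prod *
      (List.ofFn fun j =>
        momentum (σ j) ^ (monomialOfList e : (Fin k ⊕ Fin k) →₀ ℕ) (Sum.inr j)).prod := by
  rw [wordOp, monomialWord, List.map_append, List.prod_append, prod_map_flatMap, prod_map_flatMap,
    prod_map_range, prod_map_range]
  simp only [List.map_replicate, List.prod_replicate, hl, letterOp_eq_position,
    letterOp_eq_momentum]
  rfl

theorem lt_of_mem_monomialWord {k m : ℕ} (σ : Fin k → Fin m) {l e : List ℕ}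
    (hl : ∀ j : Fin k, l.getD j 0 = σ j) {u : ℕ} (hu : u ∈ monomialWord k m l e) : u < m + m := by
  rw [monomialWord, List.mem_append] at hu
  rcases hu with hu | hu <;>
  · obtain ⟨j, hj, hu⟩ := List.mem_flatMap.1 hu
    rw [List.eq_of_mem_replicate hu, hl ⟨j, List.mem_range.1 hj⟩]
    have := (σ ⟨j, List.mem_range.1 hj⟩).2
    omega

/-! ### Gaussian gates -/

/-- Entries of a matrix that is listed row by row. -/
theorem getD_flatten {α : Type*} (n : ℕ) (d : α) (L : List (List α))
    (hL : ∀ l ∈ L, l.length = n) {i j : ℕ} (hj : j < n) :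
    L.flatten.getD (n * i + j) d = (L.getD i []).getD j d := by
  induction L generalizing i with
  | nil => simp
  | cons l L ih =>
    have hl : l.length = n := hL l List.mem_cons_self
    cases i with
    | zero =>
      rw [List.flatten_cons, List.getD_append _ _ _ _ (by omega)]
      simp
    | succ i =>
      rw [List.flatten_cons, List.getD_append_right _ _ _ _ (by rw [hl, Nat.mul_succ]; omega), hl,
        show n * (i + 1) + j - n = n * i + j by rw [Nat.mul_succ]; omega,
        ih fun l hl => hL l (List.mem_cons_of_mem _ hl)]
      simp

theorem getD_params_gaussian {n : ℕ} (t c : ℝ) (b : Fin n → ℝ) (A : Matrix (Fin n) (Fin n) ℝ) :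
    (∀ u : Fin n, (t :: c :: (List.ofFn b ++ (List.ofFn fun u => List.ofFn (A u)).flatten)).getD
      (2 + u) 0 = b u) ∧
    ∀ u v : Fin n, (t :: c :: (List.ofFn b ++ (List.ofFn fun u => List.ofFn (A u)).flatten)).getD
      (2 + n + (n * u + v)) 0 = A u v := by
  constructor
  · intro u
    rw [show 2 + (u : ℕ) = u + 1 + 1 by omega, List.getD_cons_succ, List.getD_cons_succ,
      List.getD_append _ _ _ _ (by simp)]
    simp
  · intro u v
    rw [show 2 + n + (n * (u : ℕ) + v) = (n + (n * u + v)) + 1 + 1 by omega, List.getD_cons_succ,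
      List.getD_cons_succ, List.getD_append_right _ _ _ _ (by simp), List.length_ofFn,
      Nat.add_sub_cancel_left, getD_flatten n 0 _ (by simp) v.2]
    simp

/-- The coefficients and words of a quadratic Hamiltonian. -/
def quadraticTerms {m : ℕ} (A : Matrix (Fin (m + m)) (Fin (m + m)) ℝ) (b : Fin (m + m) → ℝ)
    (c : ℝ) : List (ℂ × List ℕ) :=
  ((c : ℂ), []) :: (((List.finRange (m + m)).map fun u => ((b u : ℂ), [(u : ℕ)])) ++
    (List.finRange (m + m)).flatMap fun u => (List.finRange (m + m)).map fun v =>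
      ((A u v : ℂ), [(u : ℕ), (v : ℕ)]))

theorem sum_map_finRange {M : Type*} [AddCommMonoid M] (n : ℕ) (f : Fin n → M) :
    ((List.finRange n).map f).sum = ∑ j, f j := by
  rw [← List.ofFn_eq_map, List.sum_ofFn]

theorem hamiltonianOp_quadraticTerms {m : ℕ} (A : Matrix (Fin (m + m)) (Fin (m + m)) ℝ)
    (b : Fin (m + m) → ℝ) (c : ℝ) :
    hamiltonianOp m (quadraticTerms A b c) = quadraticOp A b c := by
  simp only [hamiltonianOp, quadraticTerms, List.map_cons, List.sum_cons, List.map_append,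
    List.sum_append, List.map_map, sum_map_flatMap, sum_map_finRange, Function.comp_apply, wordOp,
    List.map_nil, List.prod_nil, List.prod_cons, mul_one, letterOp_eq_quadrature, quadraticOp]
  abel

theorem forall₂_flatMap {α β γ δ : Type*} {R : α → β → Prop} {S : γ → δ → Prop} {f : α → List γ}
    {g : β → List δ} (hfg : ∀ a b, R a b → List.Forall₂ S (f a) (g b)) {l : List α} {l' : List β}
    (h : List.Forall₂ R l l') : List.Forall₂ S (l.flatMap f) (l'.flatMap g) := by
  induction h with
  | nil => exact List.Forall₂.nil
  | cons h _ ih => exact List.rel_append (hfg _ _ h) ih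

theorem forall₂_range_finRange (n : ℕ) :
    List.Forall₂ (fun (i : ℕ) (j : Fin n) => i = j) (List.range n) (List.finRange n) := by
  rw [← List.map_coe_finRange_eq_range, List.forall₂_map_left_iff]
  exact List.forall₂_same.2 fun _ _ => rfl

theorem matches_gaussian {k m : ℕ} {A : Matrix (Fin (m + m)) (Fin (m + m)) ℝ} {hA : A.IsSymm}
    {b : Fin (m + m) → ℝ} {c t : ℝ} {r : ℕ} {row : List (List Bool)}
    (h : (Gate.gaussian A hA b c t : Gate k m).IsDescribedBy r row)
    (T : List (CoefficientList × CoefficientList)) :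
    Matches r (instruction k m T (row.map readSigned)) t (quadraticTerms A b c) := by
  obtain ⟨zs, hrow, hzs⟩ := h
  simp only [Gate.tag, Gate.params, List.cons_append, List.nil_append] at hrow hzs
  have hround (j : ℕ) : ‖(((t :: c :: (List.ofFn b ++
      (List.ofFn fun u => List.ofFn (A u)).flatten)).getD j 0 : ℝ) : ℂ) -
      dyadic ((row.map readSigned).getD (j + 1) (0, 0)).1
        ((row.map readSigned).getD (j + 1) (0, 0)).2 r‖ ≤ 1 / 2 ^ r := by
    rw [dyadic_getD, hrow, List.getD_cons_succ]
    exact (getD_of_forall₂ hzs j).norm_sub_le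
  have htail (j : ℕ) : (row.map readSigned).tail.getD j (0, 0) =
      (row.map readSigned).getD (j + 1) (0, 0) := by
    cases row.map readSigned <;> simp
  have hne : ((row.map readSigned).getD 0 (0, 0)).2 ≠ 0 := by
    rw [getD_snd, hrow]
    simp
  rw [instruction, if_neg hne]
  obtain ⟨hb, hAuv⟩ := getD_params_gaussian t c b A
  refine ⟨by simpa using hround 0, ?_⟩
  simp only [quadraticSummands, quadraticTerms, htail]
  refine List.Forall₂.cons ⟨rfl, by simpa using hround 1⟩ (List.rel_append ?_ ?_)
  · refine List.rel_map (R := fun (i : ℕ) (j : Fin (m + m)) => i = j) ?_ (forall₂_range_finRange _)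
    rintro _ u rfl
    refine ⟨rfl, ?_⟩
    have := hround (2 + u)
    rwa [hb u] at this
  · refine forall₂_flatMap (R := fun (i : ℕ) (j : Fin (m + m)) => i = j) ?_
      (forall₂_range_finRange _)
    rintro _ u rfl
    refine List.rel_map (R := fun (i : ℕ) (j : Fin (m + m)) => i = j) ?_ (forall₂_range_finRange _)
    rintro _ v rfl
    refine ⟨rfl, ?_⟩
    have := hround (2 + (m + m) + ((m + m) * u + v))
    rwa [hAuv u v] at this

theorem lt_of_mem_quadraticTerms {m : ℕ} {A : Matrix (Fin (m + m)) (Fin (m + m)) ℝ}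
    {b : Fin (m + m) → ℝ} {c : ℝ} {g : ℂ × List ℕ} (hg : g ∈ quadraticTerms A b c) {u : ℕ}
    (hu : u ∈ g.2) : u < m + m := by
  rw [quadraticTerms, List.mem_cons, List.mem_append, List.mem_map, List.mem_flatMap] at hg
  rcases hg with rfl | ⟨v, _, rfl⟩ | ⟨v, _, hg⟩
  · simp at hu
  · obtain rfl := List.mem_singleton.1 hu
    exact v.2
  · obtain ⟨v', _, rfl⟩ := List.mem_map.1 hg
    rcases List.mem_cons.1 hu with rfl | hu
    · exact v.2
    · obtain rfl := List.mem_singleton.1 hu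
      exact v'.2

/-! ### Gates of the gate set -/

/-- A list of approximate coefficients, with the integers read as signed numbers. -/
def signedCoefficients (l : List (List ℕ × ℤ × ℤ)) : CoefficientList :=
  l.map fun e => (e.1, (if e.2.1 < 0 then 2 else 0, e.2.1.natAbs),
    (if e.2.2 < 0 then 2 else 0, e.2.2.natAbs))

/-- Different lists can stand for the same monomial, since entries are ignored from the position
`2k` on and missing entries count as zero. -/
theorem monomialOfList_eq_iff {k : ℕ} {e e' : List ℕ} :
    (monomialOfList e : (Fin k ⊕ Fin k) →₀ ℕ) = monomialOfList e' ↔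
      exponents k e = exponents k e' := by
  rw [exponents, exponents, List.map_inj_left, monomialOfList, monomialOfList,
    Equiv.apply_eq_iff_eq, funext_iff]
  constructor
  · intro h j hj
    rw [List.mem_range] at hj
    by_cases hjk : j < k
    · simpa using h (Sum.inl ⟨j, hjk⟩)
    · have := h (Sum.inr ⟨j - k, by omega⟩)
      simpa [show k + (j - k) = j by omega] using this
  · rintro h (j | j)
    · simpa using h j (List.mem_range.2 (by omega))
    · simpa using h (k + j) (List.mem_range.2 (by omega))

theorem exponents_exponents (k : ℕ) (e : List ℕ) : exponents k (exponents k e) = exponents k e := by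
  refine List.map_inj_left.2 fun j hj => ?_
  have := List.mem_range.1 hj
  simp [exponents, this]

theorem monomialOfList_exponents {k : ℕ} (e : List ℕ) :
    (monomialOfList (exponents k e) : (Fin k ⊕ Fin k) →₀ ℕ) = monomialOfList e :=
  monomialOfList_eq_iff.2 (exponents_exponents k e)

theorem mem_distinctMonomials {k : ℕ} {l : CoefficientList} {e : List ℕ} :
    e ∈ distinctMonomials k l ↔ ∃ a ∈ l, exponents k a.1 = e := by
  have h (L : List (List ℕ)) : e ∈ L.foldr List.insert [] ↔ e ∈ L := by
    induction L with
    | nil => rfl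
    | cons a L ih => rw [List.foldr_cons, List.mem_insert_iff, ih, List.mem_cons]
  rw [distinctMonomials, h, List.mem_map]

theorem nodup_distinctMonomials (k : ℕ) (l : CoefficientList) : (distinctMonomials k l).Nodup := by
  rw [distinctMonomials]
  induction l.map fun a => exponents k a.1 with
  | nil => exact List.nodup_nil
  | cons a L ih => exact ih.insert

theorem findCoefficient_spec {k r : ℕ} {p : MvPolynomial (Fin k ⊕ Fin k) ℂ}
    {l : List (List ℕ × ℤ × ℤ)} (h : ApproximatesPolynomial r l p) {e : List ℕ}
    (he : exponents k e = e) :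
    ‖((p.coeff (monomialOfList e)).re : ℂ) -
      dyadic (findCoefficient k (signedCoefficients l) e).1.1
        (findCoefficient k (signedCoefficients l) e).1.2 r‖ ≤ 1 / 2 ^ r ∧
    ‖((p.coeff (monomialOfList e)).im : ℂ) -
      dyadic (findCoefficient k (signedCoefficients l) e).2.1
        (findCoefficient k (signedCoefficients l) e).2.2 r‖ ≤ 1 / 2 ^ r := by
  have key (l' : List (List ℕ × ℤ × ℤ)) (hl' : ∀ a ∈ l', a ∈ l) :
      (findCoefficient k (signedCoefficients l') e = ((0, 0), (0, 0)) ∧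
        ∀ a ∈ l', exponents k a.1 ≠ e) ∨
      ∃ a ∈ l, exponents k a.1 = e ∧ findCoefficient k (signedCoefficients l') e =
        ((if a.2.1 < 0 then 2 else 0, a.2.1.natAbs),
          (if a.2.2 < 0 then 2 else 0, a.2.2.natAbs)) := by
    induction l' with
    | nil => exact Or.inl ⟨rfl, by simp⟩
    | cons a l' ih =>
      have ih := ih fun b hb => hl' b (List.mem_cons_of_mem _ hb)
      have hcons : findCoefficient k (signedCoefficients (a :: l')) e =
          if exponents k a.1 = e then ((if a.2.1 < 0 then 2 else 0, a.2.1.natAbs),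
            (if a.2.2 < 0 then 2 else 0, a.2.2.natAbs))
          else findCoefficient k (signedCoefficients l') e := rfl
      by_cases hae : exponents k a.1 = e
      · exact Or.inr ⟨a, hl' a List.mem_cons_self, hae, by rw [hcons, if_pos hae]⟩
      · rw [hcons, if_neg hae]
        rcases ih with ⟨h1, h2⟩ | h1
        · exact Or.inl ⟨h1, List.forall_mem_cons.2 ⟨hae, h2⟩⟩
        · exact Or.inr h1
  rcases key l fun _ h => h with ⟨h0, hne⟩ | ⟨a, ha, hae, h0⟩
  · have hcoeff : p.coeff (monomialOfList e) = 0 := by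
      by_contra hc
      obtain ⟨a, ha, hae⟩ := h.1 _ (MvPolynomial.mem_support_iff.2 hc)
      exact hne a ha ((monomialOfList_eq_iff.1 hae).trans he)
    rw [h0, hcoeff]
    simp [dyadic]
  · have hmon : (monomialOfList a.1 : (Fin k ⊕ Fin k) →₀ ℕ) = monomialOfList e :=
      monomialOfList_eq_iff.2 (hae.trans he.symm)
    have := h.2 a ha
    rw [hmon] at this
    rw [h0]
    simp only [dyadic_int]
    exact ⟨this.1.norm_sub_le, this.2.norm_sub_le⟩

/-- The coefficients and words of a polynomial in the quadratures. -/
def polynomialTerms {k : ℕ} (m : ℕ) (σ : List ℕ) (p : MvPolynomial (Fin k ⊕ Fin k) ℂ)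
    (l : CoefficientList) : List (ℂ × List ℕ) :=
  (distinctMonomials k l).flatMap fun e =>
    [(((p.coeff (monomialOfList e)).re : ℂ), monomialWord k m σ e),
      (I * ((p.coeff (monomialOfList e)).im : ℂ), monomialWord k m σ e)]

theorem hamiltonianOp_polynomialTerms {k m r : ℕ} (σ : Fin k → Fin m) {σl : List ℕ}
    (hσ : ∀ j : Fin k, σl.getD j 0 = σ j) {p : MvPolynomial (Fin k ⊕ Fin k) ℂ}
    {l : List (List ℕ × ℤ × ℤ)} (h : ApproximatesPolynomial r l p) :
    hamiltonianOp m (polynomialTerms m σl p (signedCoefficients l)) = polynomialOp σ p := by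
  set E := distinctMonomials k (signedCoefficients l)
  have hE {e : List ℕ} : e ∈ E ↔ ∃ a ∈ l, exponents k a.1 = e := by
    rw [mem_distinctMonomials, signedCoefficients]
    simp
  have hEn {e : List ℕ} (he : e ∈ E) : exponents k e = e := by
    obtain ⟨a, _, rfl⟩ := hE.1 he
    exact exponents_exponents k _
  have hinj : Set.InjOn (fun e => (monomialOfList e : (Fin k ⊕ Fin k) →₀ ℕ))
      (E.toFinset : Set (List ℕ)) := by
    intro e he e' he' hee
    rw [Finset.mem_coe, List.mem_toFinset] at he he'
    have := monomialOfList_eq_iff.1 hee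
    rwa [hEn he, hEn he'] at this
  have h1 : hamiltonianOp m (polynomialTerms m σl p (signedCoefficients l)) =
      (E.map fun e => p.coeff (monomialOfList e) • wordOp m (monomialWord k m σl e)).sum := by
    rw [hamiltonianOp, polynomialTerms, sum_map_flatMap]
    congr 1
    refine List.map_congr_left fun e _ => ?_
    simp only [List.map_cons, List.map_nil, List.sum_cons, List.sum_nil, add_zero, ← add_smul]
    rw [mul_comm, Complex.re_add_im]
  rw [h1, ← List.sum_toFinset _ (nodup_distinctMonomials _ _), polynomialOp]
  simp only [wordOp_monomialWord σ σl _ hσ]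
  rw [← Finset.sum_image (s := E.toFinset)
    (g := fun e => (monomialOfList e : (Fin k ⊕ Fin k) →₀ ℕ)) (f := fun s => p.coeff s •
    ((List.ofFn fun j => position (σ j) ^ s (Sum.inl j)).prod *
      (List.ofFn fun j => momentum (σ j) ^ s (Sum.inr j)).prod)) hinj]
  symm
  refine Finset.sum_subset ?_ fun s _ hs => ?_
  · intro s hs
    obtain ⟨a, ha, rfl⟩ := h.1 s hs
    rw [Finset.mem_image]
    exact ⟨exponents k a.1, List.mem_toFinset.2 (hE.2 ⟨a, ha, rfl⟩), monomialOfList_exponents _⟩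
  · rw [MvPolynomial.notMem_support_iff.1 hs, zero_smul]

theorem matches_fromSet {k m : ℕ} {i : ℕ} {σ : Fin k ↪ Fin m} {t : ℝ} {r : ℕ}
    {row : List (List Bool)} (h : (Gate.fromSet i σ t : Gate k m).IsDescribedBy r row)
    {T : List (CoefficientList × CoefficientList)} {p : MvPolynomial (Fin k ⊕ Fin k) ℂ}
    {l l' : List (List ℕ × ℤ × ℤ)}
    (hl : ApproximatesPolynomial r l p)
    (hT : T.getD i ([], []) = (signedCoefficients l', signedCoefficients l)) :
    Matches r (instruction k m T (row.map readSigned)) t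
      (polynomialTerms m (List.ofFn fun j => (σ j : ℕ)) p (signedCoefficients l')) := by
  obtain ⟨zs, hrow, hzs⟩ := h
  simp only [Gate.tag, Gate.params, List.cons_append] at hrow hzs
  have h0 : ((row.map readSigned).getD 0 (0, 0)).2 = 0 := by
    rw [getD_snd, hrow]
    simp
  have h1 : ((row.map readSigned).getD 1 (0, 0)).2 = i := by
    rw [getD_snd, hrow]
    simp
  have h2 : (List.range k).map (fun j => ((row.map readSigned).getD (2 + j) (0, 0)).2) =
      List.ofFn fun j => (σ j : ℕ) := by
    rw [← List.map_coe_finRange_eq_range, List.map_map, List.ofFn_eq_map]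
    refine List.map_congr_left fun j _ => ?_
    rw [Function.comp_apply, getD_snd, hrow, show 2 + (j : ℕ) = j + 1 + 1 by omega,
      List.getD_cons_succ, List.getD_cons_succ, List.getD_append _ _ _ _ (by simp)]
    simp
  have h3 : ‖(t : ℂ) - dyadic ((row.map readSigned).getD (2 + k) (0, 0)).1
      ((row.map readSigned).getD (2 + k) (0, 0)).2 r‖ ≤ 1 / 2 ^ r := by
    have := (getD_of_forall₂ hzs 0).norm_sub_le
    rw [dyadic_getD, hrow, show 2 + k = k + 1 + 1 by omega, List.getD_cons_succ,
      List.getD_cons_succ, List.getD_append_right _ _ _ _ (by simp)]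
    simpa using this
  rw [instruction, if_pos h0, h1, h2, hT]
  refine ⟨h3, ?_⟩
  refine forall₂_flatMap (R := fun e e' => e = e' ∧ exponents k e = e) ?_ ?_
  · rintro e _ ⟨rfl, he⟩
    obtain ⟨hre, him⟩ := findCoefficient_spec hl he
    refine .cons ⟨rfl, hre⟩ (.cons ⟨rfl, ?_⟩ .nil)
    rw [dyadic_succ, ← mul_sub, norm_mul, Complex.norm_I, one_mul]
    exact him
  · refine List.forall₂_same.2 fun e he => ⟨rfl, ?_⟩
    obtain ⟨a, _, rfl⟩ := mem_distinctMonomials.1 he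
    exact exponents_exponents k _

/-- The table of the coefficients of the first `M` Hamiltonians of a gate set. The list of monomials
comes from the precision `0`, in order that it does not depend on the precision `r`. -/
def gateTable (F : ℕ → ℕ → List (List ℕ × ℤ × ℤ)) (r M : ℕ) :
    List (CoefficientList × CoefficientList) :=
  (List.range M).map fun i => (signedCoefficients (F i 0), signedCoefficients (F i r))

/-- Every gate has a Hamiltonian `∑ γ • w` with words `w` that do not depend on the precision, and
the instruction that is read off a description of the gate approximates it. -/
theorem exists_matches {𝒢 : GateSet} {F : ℕ → ℕ → List (List ℕ × ℤ × ℤ)}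
    (hF : ∀ i r, ApproximatesPolynomial r (F i r) (𝒢.ham i)) {m : ℕ} (g : Gate 𝒢.modes m) :
    ∃ Γ : List (ℂ × List ℕ), (∀ e ∈ Γ, ∀ u ∈ e.2, u < m + m) ∧
      g.hamiltonian 𝒢 = unboundedOp (hamiltonianOp m Γ) ∧
      ∀ M r row, ((row.map readSigned).getD 1 (0, 0)).2 < M → g.IsDescribedBy r row →
        Matches r (instruction 𝒢.modes m (gateTable F r M) (row.map readSigned)) g.time Γ := by
  cases g with
  | fromSet i σ t =>
    have hσ (j : Fin 𝒢.modes) : (List.ofFn fun j => (σ j : ℕ)).getD j 0 = σ j := by simp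
    refine ⟨polynomialTerms m (List.ofFn fun j => (σ j : ℕ)) (𝒢.ham i)
      (signedCoefficients (F i 0)), fun e he u hu => ?_, ?_, fun M r row hM h => ?_⟩
    · rw [polynomialTerms, List.mem_flatMap] at he
      obtain ⟨e', _, he⟩ := he
      have : e.2 = monomialWord 𝒢.modes m (List.ofFn fun j => (σ j : ℕ)) e' := by
        rcases List.mem_cons.1 he with rfl | he
        · rfl
        · rw [List.mem_singleton.1 he]
      rw [this] at hu
      exact lt_of_mem_monomialWord σ hσ hu
    · rw [hamiltonianOp_polynomialTerms σ hσ (hF i 0)]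
      rfl
    · refine matches_fromSet h (hF i r) ?_
      have hi : i < M := by
        obtain ⟨zs, hrow, -⟩ := h
        rw [getD_snd, hrow] at hM
        simpa [Gate.tag] using hM
      simp [gateTable, hi]
  | gaussian A hA b c t =>
    refine ⟨quadraticTerms A b c, fun e he u hu => lt_of_mem_quadraticTerms he hu, ?_,
      fun M r row _ h => matches_gaussian h _⟩
    rw [hamiltonianOp_quadraticTerms]
    rfl

open Filter

/-! ### The tests are sound and complete -/

theorem norm_dyadic (q n d : ℕ) : ‖dyadic q n d‖ = n / 2 ^ d := by
  simp [dyadic]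

/-- The error of a product of two rounded numbers. -/
theorem norm_mul_sub_le {t : ℝ} {γ : ℂ} {q n q' n' r : ℕ}
    (ht : ‖(t : ℂ) - dyadic q n r‖ ≤ 1 / 2 ^ r) (hγ : ‖γ - dyadic q' n' r‖ ≤ 1 / 2 ^ r) :
    ‖(t : ℂ) * γ - dyadic q n r * dyadic q' n' r‖ ≤ (n + n' + 1 : ℕ) / 4 ^ r := by
  have h4 : (4 : ℝ) ^ r = 2 ^ r * 2 ^ r := by rw [← mul_pow]; norm_num
  have ht' : ‖(t : ℂ)‖ ≤ n / 2 ^ r + 1 / 2 ^ r := by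
    have := norm_add_le ((t : ℂ) - dyadic q n r) (dyadic q n r)
    rw [sub_add_cancel, norm_dyadic] at this
    linarith
  have h : (t : ℂ) * γ - dyadic q n r * dyadic q' n' r =
      t * (γ - dyadic q' n' r) + (t - dyadic q n r) * dyadic q' n' r := by ring
  rw [h]
  refine (norm_add_le _ _).trans ?_
  rw [norm_mul, norm_mul, norm_dyadic]
  calc ‖(t : ℂ)‖ * ‖γ - dyadic q' n' r‖ + ‖(t : ℂ) - dyadic q n r‖ * (n' / 2 ^ r)
      ≤ (n / 2 ^ r + 1 / 2 ^ r) * (1 / 2 ^ r) + 1 / 2 ^ r * (n' / 2 ^ r) := by gcongr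
    _ = (n + n' + 1 : ℕ) / 4 ^ r := by
      rw [h4]
      push_cast
      field_simp
      ring

/-- The rounding of the parameters causes an error of at most `errorBound / 4 ^ r`. -/
theorem norm_generatorAct_sub_le {m r : ℕ} {ι : Instruction} {t : ℝ} {Γ : List (ℂ × List ℕ)}
    (hΓ : ∀ e ∈ Γ, ∀ u ∈ e.2, u < m + m) (h : Matches r ι t Γ) (x : StateCode) :
    ‖toFock m ((I * t) • hamiltonianOp m Γ (codeState m x)) -
      toFock m (codeState m (generatorAct m r ι x))‖ ≤ errorBound m ι x / 4 ^ r := by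
  obtain ⟨⟨q, n⟩, es⟩ := ι
  obtain ⟨ht, hes⟩ := h
  dsimp only at ht hes
  induction hes with
  | nil => simp [hamiltonianOp, generatorAct, errorBound]
  | @cons e g es Γ heg _ ih =>
    obtain ⟨q', n', w⟩ := e
    obtain ⟨γ, w'⟩ := g
    obtain ⟨rfl, hγ⟩ := heg
    have ih := ih fun e he => hΓ e (List.mem_cons_of_mem _ he)
    have hw := codeState_wordAct (m := m) (hΓ _ List.mem_cons_self) x
    dsimp only at hγ hw
    have h1 : toFock m ((I * t) • hamiltonianOp m ((γ, w) :: Γ) (codeState m x)) =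
        (I * (t * γ)) • toFock m (codeState m (wordAct m w x)) +
          toFock m ((I * t) • hamiltonianOp m Γ (codeState m x)) := by
      rw [hw, ← map_smul (toFock m), ← map_add (toFock m)]
      congr 1
      simp only [hamiltonianOp, List.map_cons, List.sum_cons, LinearMap.add_apply,
        LinearMap.smul_apply]
      module
    have h2 : toFock m (codeState m (generatorAct m r ((q, n), (q', n', w) :: es) x)) =
        (I * (dyadic q n r * dyadic q' n' r)) • toFock m (codeState m (wordAct m w x)) +
          toFock m (codeState m (generatorAct m r ((q, n), es) x)) := by
      rw [generatorAct, List.flatMap_cons, codeState_append, codeState_scaleCode, dyadic_succ,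
        ← dyadic_mul, map_add, map_smul]
      rfl
    rw [h1, h2, add_sub_add_comm, ← sub_smul, ← mul_sub, errorBound, List.map_cons, List.sum_cons,
      Nat.cast_add, add_div]
    refine (norm_add_le _ _).trans (add_le_add ?_ ih)
    rw [norm_smul, norm_mul, Complex.norm_I, one_mul, Nat.cast_mul, mul_div_right_comm]
    exact mul_le_mul (norm_mul_sub_le ht hγ) (norm_codeState_le m _) (norm_nonneg _)
      (by positivity)

theorem toFock_defectCode {m r K : ℕ} {ι : Instruction} {c c' x : StateCode} :
    toFock m (codeState m (scaleCode 0 K 0 c' ++ (scaleCode 2 K 0 c ++ generatorAct m r ι x))) =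
      toFock m ((K : ℂ) • (codeState m c' - codeState m c)) +
        toFock m (codeState m (generatorAct m r ι x)) := by
  rw [codeState_append, codeState_append, codeState_scaleCode, codeState_scaleCode, ← map_add]
  congr 1
  simp only [dyadic, pow_zero, one_mul, div_one, Complex.I_sq]
  module

theorem DefectTest.defect_le {m r s K : ℕ} {ι : Instruction} {t : ℝ} {Γ : List (ℂ × List ℕ)}
    (hΓ : ∀ e ∈ Γ, ∀ u ∈ e.2, u < m + m) (h : Matches r ι t Γ) {c c' x : StateCode}
    (hT : DefectTest m r s ι K c c' x) :
    IsPropagator.defect (hamiltonianOp m Γ) t K c c' (codeState m x) ≤ 2 / 2 ^ s := by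
  have h1 := (normLE_iff m s _).1 hT.1
  rw [toFock_defectCode] at h1
  have h2 := norm_generatorAct_sub_le hΓ h x
  have h3 : (errorBound m ι x : ℝ) / 4 ^ r ≤ 1 / 2 ^ s := by
    rw [div_le_div_iff₀ (by positivity) (by positivity), one_mul]
    exact_mod_cast hT.2
  rw [IsPropagator.defect, map_add]
  have h4 := norm_add_le
    (toFock m ((K : ℂ) • (codeState m c' - codeState m c)) +
        toFock m (codeState m (generatorAct m r ι x)))
    (toFock m ((I * t) • hamiltonianOp m Γ (codeState m x)) -
      toFock m (codeState m (generatorAct m r ι x)))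
  rw [add_add_sub_cancel] at h4
  have h5 : (2 : ℝ) / 2 ^ s = 1 / 2 ^ s + 1 / 2 ^ s := by ring
  rw [h5]
  linarith

theorem le_of_norm_sub_dyadic_le {z : ℂ} {q n r : ℕ} (h : ‖z - dyadic q n r‖ ≤ 1 / 2 ^ r) :
    (n : ℝ) + 1 ≤ (‖z‖ + 2) * 2 ^ r := by
  have h2 : (1 : ℝ) ≤ 2 ^ r := one_le_pow₀ (by norm_num)
  have h3 : (n : ℝ) / 2 ^ r ≤ ‖z‖ + 1 / 2 ^ r := by
    rw [← norm_dyadic q]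
    have := norm_sub_norm_le (dyadic q n r) z
    rw [norm_sub_rev] at this
    linarith
  rw [div_le_iff₀ (by positivity), add_mul, one_div, inv_mul_cancel₀ (by positivity)] at h3
  nlinarith

/-- The error bound grows at most like `2 ^ r`, so that the error itself, which is bounded by
`errorBound / 4 ^ r`, tends to zero. -/
theorem exists_errorBound_le (m : ℕ) (t : ℝ) (Γ : List (ℂ × List ℕ)) (x : StateCode) :
    ∃ B : ℝ, ∀ r ι, Matches r ι t Γ → (errorBound m ι x : ℝ) ≤ B * 2 ^ r := by
  refine ⟨(Γ.map fun g => ((‖(t : ℂ)‖ + 2) + (‖g.1‖ + 2)) * normBound m (wordAct m g.2 x)).sum, ?_⟩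
  rintro r ⟨⟨q, n⟩, es⟩ ⟨ht, hes⟩
  dsimp only at ht hes
  induction hes with
  | nil => simp [errorBound]
  | @cons e g es Γ heg _ ih =>
    obtain ⟨q', n', w⟩ := e
    obtain ⟨γ, w'⟩ := g
    obtain ⟨rfl, hγ⟩ := heg
    rw [errorBound, List.map_cons, List.sum_cons, List.map_cons, List.sum_cons, Nat.cast_add]
    refine le_of_le_of_eq (add_le_add ?_ ih) (add_mul _ _ _).symm
    rw [Nat.cast_mul, mul_right_comm]
    refine mul_le_mul_of_nonneg_right ?_ (Nat.cast_nonneg _)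
    have h1 := le_of_norm_sub_dyadic_le ht
    have h2 := le_of_norm_sub_dyadic_le hγ
    push_cast
    dsimp only at h2 ⊢
    linarith

/-- A defect that is small for the exact parameters passes the test for all parameters that are
close enough to them. -/
theorem eventually_defectTest {m : ℕ} (s K : ℕ) {t : ℝ} {Γ : List (ℂ × List ℕ)}
    (hΓ : ∀ e ∈ Γ, ∀ u ∈ e.2, u < m + m) {c c' x : StateCode}
    (hd : IsPropagator.defect (hamiltonianOp m Γ) t K c c' (codeState m x) < 1 / 2 ^ (s + 1)) :
    ∀ᶠ r in atTop, ∀ ι, Matches r ι t Γ → DefectTest m r s ι K c c' x := by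
  obtain ⟨B, hB⟩ := exists_errorBound_le m t Γ x
  have hlim : ∀ᶠ r : ℕ in atTop, B * 2 ^ (s + 1) ≤ 2 ^ r :=
    (tendsto_pow_atTop_atTop_of_one_lt (by norm_num : (1 : ℝ) < 2)).eventually_ge_atTop _
  filter_upwards [hlim] with r hr ι hι
  have h4 : (4 : ℝ) ^ r = 2 ^ r * 2 ^ r := by rw [← mul_pow]; norm_num
  have herr : (errorBound m ι x : ℝ) / 4 ^ r ≤ 1 / 2 ^ (s + 1) := by
    rw [div_le_div_iff₀ (by positivity) (by positivity), one_mul, h4]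
    calc (errorBound m ι x : ℝ) * 2 ^ (s + 1) ≤ B * 2 ^ r * 2 ^ (s + 1) := by
          gcongr
          exact hB r ι hι
      _ = B * 2 ^ (s + 1) * 2 ^ r := by ring
      _ ≤ 2 ^ r * 2 ^ r := by gcongr
  have hs : (1 : ℝ) / 2 ^ (s + 1) + 1 / 2 ^ (s + 1) = 1 / 2 ^ s := by
    rw [pow_succ]
    field_simp
    norm_num
  constructor
  · rw [normLE_iff, toFock_defectCode]
    have h2 := norm_generatorAct_sub_le hΓ hι x
    rw [IsPropagator.defect, map_add] at hd
    have h5 := norm_sub_le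
      (toFock m ((K : ℂ) • (codeState m c' - codeState m c)) +
        toFock m ((I * t) • hamiltonianOp m Γ (codeState m x)))
      (toFock m ((I * t) • hamiltonianOp m Γ (codeState m x)) -
        toFock m (codeState m (generatorAct m r ι x)))
    have h7 (u v w : Fock m) : u + v - (v - w) = u + w := by abel
    rw [h7] at h5
    linarith
  · have h6 : (errorBound m ι x : ℝ) / 4 ^ r ≤ 1 / 2 ^ s := by
      have : (0 : ℝ) < 1 / 2 ^ (s + 1) := by positivity
      linarith
    rw [div_le_div_iff₀ (by positivity) (by positivity), one_mul] at h6
    exact_mod_cast h6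

theorem foldl_and_decide {α : Type*} (P : α → α → Prop) [DecidableRel P] (b : Bool) (c : α)
    (l : List α) :
    (l.foldl (fun p c' => (p.1 && decide (P p.2 c'), c')) (b, c)).2 = l.getLastD c ∧
      ((l.foldl (fun p c' => (p.1 && decide (P p.2 c'), c')) (b, c)).1 = true ↔
        b = true ∧ (c :: l).IsChain P) := by
  induction l generalizing b c with
  | nil => simp
  | cons c' l ih =>
    obtain ⟨h1, h2⟩ := ih (b && decide (P c c')) c'
    rw [List.foldl_cons, h1, h2, List.getLastD_cons, List.isChain_cons_cons]
    simp [and_assoc]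

theorem gateTest_snd (m r s : ℕ) (ι : Instruction) (p : Bool × StateCode) (l : List StateCode) :
    (gateTest m r s ι p l).2 = l.getLastD p.2 :=
  (foldl_and_decide (SegmentTest m r s ι l.length) _ p.2 l).1

theorem gateTest_fst (m r s : ℕ) (ι : Instruction) (p : Bool × StateCode) (l : List StateCode) :
    (gateTest m r s ι p l).1 = true ↔ (p.1 = true ∧ l ≠ []) ∧
      (p.2 :: l).IsChain (SegmentTest m r s ι l.length) := by
  refine (foldl_and_decide (SegmentTest m r s ι l.length) _ p.2 l).2.trans ?_
  simp

/-- A polygon that passes the test ends close to the exact evolution of its starting point. -/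
theorem gateTest_sound {m r s : ℕ} {ι : Instruction} {t : ℝ} {Γ : List (ℂ × List ℕ)}
    (hΓ : ∀ e ∈ Γ, ∀ u ∈ e.2, u < m + m) (h : Matches r ι t Γ)
    {U : ℝ → (Fock m ≃ₗᵢ[ℂ] Fock m)} (hU : IsPropagator (unboundedOp (hamiltonianOp m Γ)) U)
    {p : Bool × StateCode} {l : List StateCode} (hl : (gateTest m r s ι p l).1 = true) :
    p.1 = true ∧ ‖U t (toFock m (codeState m p.2)) -
      toFock m (codeState m (gateTest m r s ι p l).2)‖ ≤ 2 / 2 ^ s := by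
  rw [gateTest_fst] at hl
  obtain ⟨⟨hp, hne⟩, hchain⟩ := hl
  refine ⟨hp, ?_⟩
  have hK : l.length ≠ 0 := by simpa using hne
  have hK' : (l.length : ℝ) ≠ 0 := Nat.cast_ne_zero.2 hK
  have := hU.norm_apply_sub_le_of_isChain (t := t) (δ := 2 / 2 ^ s) hK
    (hchain.imp fun a b hab => ⟨hab.1.defect_le hΓ h, hab.2.defect_le hΓ h⟩)
  rw [gateTest_snd]
  rwa [mul_div_cancel_left₀ _ hK', mul_div_cancel₀ _ hK'] at this

theorem isChain_eventually {α : Type*} {P : α → α → Prop} {Q : ℕ → α → α → Prop}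
    (hPQ : ∀ a b, P a b → ∀ᶠ r in atTop, Q r a b) {l : List α} (hl : l.IsChain P) :
    ∀ᶠ r in atTop, l.IsChain (Q r) := by
  induction hl with
  | nil => exact Eventually.of_forall fun _ => .nil
  | singleton a => exact Eventually.of_forall fun _ => .singleton a
  | cons_cons h _ ih =>
    filter_upwards [hPQ _ _ h, ih] with r h1 h2
    exact .cons_cons h1 h2

/-- Every gate has a polygon that passes the test, provided that the precision is high enough. -/
theorem gateTest_complete {m : ℕ} (s : ℕ) {t : ℝ} {Γ : List (ℂ × List ℕ)}
    (hΓ : ∀ e ∈ Γ, ∀ u ∈ e.2, u < m + m) {U : ℝ → (Fock m ≃ₗᵢ[ℂ] Fock m)}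
    (hU : IsPropagator (unboundedOp (hamiltonianOp m Γ)) U) (c : StateCode) :
    ∃ l : List StateCode, ∀ᶠ r in atTop, ∀ ι, Matches r ι t Γ →
      (gateTest m r s ι (true, c) l).1 = true := by
  obtain ⟨l, hne, hl⟩ := hU.exists_isChain t c (δ := 1 / 2 ^ (s + 1)) (by positivity)
  refine ⟨l, ?_⟩
  have h := isChain_eventually
    (Q := fun r a b => ∀ ι, Matches r ι t Γ → SegmentTest m r s ι l.length a b)
    (fun a b hab => by
      filter_upwards [eventually_defectTest s l.length hΓ hab.1,
        eventually_defectTest s l.length hΓ hab.2] with r h1 h2 ι hι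
      exact ⟨h1 ι hι, h2 ι hι⟩) hl
  filter_upwards [h] with r hr ι hι
  rw [gateTest_fst]
  exact ⟨⟨rfl, hne⟩, hr.imp fun a b hab => hab ι hι⟩

section Circuit

variable {𝒢 : GateSet} {F : ℕ → ℕ → List (List ℕ × ℤ × ℤ)} {m : ℕ} {U : Unitaries 𝒢.modes m}

/-- If all tests succeed, then the coded state that they end with is close to the output of the
circuit. -/
theorem circuitTest_sound (hF : ∀ i r, ApproximatesPolynomial r (F i r) (𝒢.ham i))
    {gs : List (Gate 𝒢.modes m)} (hU : ∀ g ∈ gs, IsPropagator (g.hamiltonian 𝒢) (U g)) {r M : ℕ}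
    {rows : List (List (List Bool))}
    (hrows : List.Forall₂ (fun g row => g.IsDescribedBy r row) gs rows)
    (hM : ∀ row ∈ rows, ((row.map readSigned).getD 1 (0, 0)).2 < M) (s : ℕ)
    (p : (Bool × StateCode) × List (List StateCode)) (φ : Fock m)
    (h : (circuitTest 𝒢.modes m r s (gateTable F r M) (rows.map fun row => row.map readSigned)
      p).1.1 = true) :
    p.1.1 = true ∧ ‖finalState U gs φ - toFock m (codeState m (circuitTest 𝒢.modes m r s
      (gateTable F r M) (rows.map fun row => row.map readSigned) p).1.2)‖ ≤
        ‖φ - toFock m (codeState m p.1.2)‖ + gs.length * (2 / 2 ^ s) := by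
  induction hrows generalizing p φ with
  | nil => exact ⟨h, by simp [circuitTest, finalState]⟩
  | @cons g row gs rows hg _ ih =>
    obtain ⟨Γ, hΓ, hH, hmatch⟩ := exists_matches hF g
    have hUg := hU g List.mem_cons_self
    rw [hH] at hUg
    have hι := hmatch M r row (hM row List.mem_cons_self) hg
    rw [List.map_cons] at h ⊢
    simp only [circuitTest, List.foldl_cons] at h ⊢
    obtain ⟨h1, h2⟩ := ih (fun g hg => hU g (List.mem_cons_of_mem _ hg))
      (fun row hrow => hM row (List.mem_cons_of_mem _ hrow)) _ (U g g.time φ) h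
    obtain ⟨h3, h4⟩ := gateTest_sound hΓ hι hUg h1
    refine ⟨h3, h2.trans ?_⟩
    have h5 := norm_sub_le_norm_sub_add_norm_sub (U g g.time φ)
      (U g g.time (toFock m (codeState m p.1.2)))
      (toFock m (codeState m (gateTest m r s (instruction 𝒢.modes m (gateTable F r M)
        (row.map readSigned)) p.1 (p.2.getD 0 [])).2))
    rw [← map_sub, LinearIsometryEquiv.norm_map] at h5
    rw [List.length_cons]
    push_cast
    linarith

/-- For a suitable list of polygons all tests succeed, provided that the precision is high enough.
The list does not depend on the precision: the polygon for a gate is chosen for its exact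
parameters, and starts at the end point of the polygon for the preceding gate. -/
theorem circuitTest_complete (hF : ∀ i r, ApproximatesPolynomial r (F i r) (𝒢.ham i))
    {gs : List (Gate 𝒢.modes m)} (hU : ∀ g ∈ gs, IsPropagator (g.hamiltonian 𝒢) (U g)) (s : ℕ)
    (c : StateCode) :
    ∃ L : List (List StateCode), ∀ᶠ r in atTop, ∀ M rows,
      List.Forall₂ (fun g row => g.IsDescribedBy r row) gs rows →
      (∀ row ∈ rows, ((row.map readSigned).getD 1 (0, 0)).2 < M) →
      (circuitTest 𝒢.modes m r s (gateTable F r M) (rows.map fun row => row.map readSigned)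
        ((true, c), L)).1.1 = true := by
  induction gs generalizing c with
  | nil =>
    refine ⟨[], Eventually.of_forall fun r M rows h _ => ?_⟩
    obtain rfl := List.forall₂_nil_left_iff.1 h
    rfl
  | cons g gs ih =>
    obtain ⟨Γ, hΓ, hH, hmatch⟩ := exists_matches hF g
    have hUg := hU g List.mem_cons_self
    rw [hH] at hUg
    obtain ⟨l, hl⟩ := gateTest_complete s (t := g.time) hΓ hUg c
    obtain ⟨L, hL⟩ := ih (fun g hg => hU g (List.mem_cons_of_mem _ hg)) (l.getLastD c)
    refine ⟨l :: L, ?_⟩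
    filter_upwards [hl, hL] with r h1 h2 M rows hrows hM
    obtain ⟨row, rows, hg, hgs, rfl⟩ := List.forall₂_cons_left_iff.1 hrows
    have h3 := h1 _ (hmatch M r row (hM row List.mem_cons_self) hg)
    have h4 := h2 M rows hgs fun row hrow => hM row (List.mem_cons_of_mem _ hrow)
    rw [List.map_cons]
    simp only [circuitTest, List.foldl_cons, List.tail_cons, List.getD_cons_zero] at h4 ⊢
    have h5 : gateTest m r s (instruction 𝒢.modes m (gateTable F r M) (row.map readSigned))
        (true, c) l = (true, l.getLastD c) :=
      Prod.ext h3 (gateTest_snd ..)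
    rw [h5]
    exact h4

end Circuit

/-! ### The measurement -/

section Measurement

variable {m : ℕ}

theorem summable_norm_sq (ψ : Fock m) : Summable fun n => ‖ψ n‖ ^ 2 := by
  have := (lp.memℓp ψ).summable (by norm_num)
  simpa using this

theorem norm_sq_eq_tsum (ψ : Fock m) : ‖ψ‖ ^ 2 = ∑' n, ‖ψ n‖ ^ 2 := by
  have := lp.norm_rpow_eq_tsum (p := 2) (by norm_num) ψ
  simpa using this

theorem norm_indicator_sq (T : Set (Fin m → ℕ)) (ψ : (Fin m → ℕ) → ℂ) (n : Fin m → ℕ) :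
    ‖T.indicator ψ n‖ ^ 2 = T.indicator (fun n => ‖ψ n‖ ^ 2) n := by
  by_cases h : n ∈ T <;> simp [h]

/-- The projection onto the span of the Fock states in `T`. -/
def restriction (T : Set (Fin m → ℕ)) : Fock m →ₗ[ℂ] Fock m where
  toFun ψ := ⟨T.indicator ψ, memℓp_gen (by
    simpa [norm_indicator_sq] using (summable_norm_sq ψ).indicator T)⟩
  map_add' ψ φ := by ext n; exact congrFun (Set.indicator_add T ψ φ) n
  map_smul' z ψ := by ext n; exact congrFun (Set.indicator_const_smul T z ψ) n

theorem restriction_apply (T : Set (Fin m → ℕ)) (ψ : Fock m) (n : Fin m → ℕ) :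
    restriction T ψ n = T.indicator ψ n := rfl

theorem norm_restriction_sq (T : Set (Fin m → ℕ)) (ψ : Fock m) :
    ‖restriction T ψ‖ ^ 2 = ∑' n : T, ‖ψ n‖ ^ 2 := by
  rw [norm_sq_eq_tsum, tsum_subtype T fun n => ‖ψ n‖ ^ 2]
  exact tsum_congr fun n => norm_indicator_sq T ψ n

theorem norm_restriction_sq_add_le {T T' : Set (Fin m → ℕ)} (h : Disjoint T T') (ψ : Fock m) :
    ‖restriction T ψ‖ ^ 2 + ‖restriction T' ψ‖ ^ 2 ≤ ‖ψ‖ ^ 2 := by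
  have hs := summable_norm_sq ψ
  rw [norm_restriction_sq, norm_restriction_sq, norm_sq_eq_tsum ψ,
    ← (hs.subtype T).tsum_union_disjoint h (hs.subtype T')]
  exact hs.tsum_subtype_le (fun n => ‖ψ n‖ ^ 2) _ fun n => sq_nonneg _

theorem norm_restriction_le (T : Set (Fin m → ℕ)) (ψ : Fock m) : ‖restriction T ψ‖ ≤ ‖ψ‖ := by
  have := norm_restriction_sq_add_le (Set.disjoint_empty T) ψ
  exact (sq_le_sq₀ (norm_nonneg _) (norm_nonneg _)).1
    ((le_add_of_nonneg_right (sq_nonneg _)).trans this)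

/-- On coded states, the projection is computed by discarding terms. -/
theorem restriction_codeState (hm : 0 < m) (a b : ℕ) (c : StateCode) :
    restriction {n | n ⟨0, hm⟩ ∈ Set.Icc a b} (toFock m (codeState m c)) =
      toFock m (codeState m (restrictCode a b c)) := by
  induction c with
  | nil => simp [restrictCode]
  | cons t c ih =>
    have ht : restriction {n | n ⟨0, hm⟩ ∈ Set.Icc a b} (toFock m (termState m t)) =
        if a ≤ t.2.2.2.getD 0 0 ∧ t.2.2.2.getD 0 0 ≤ b then toFock m (termState m t) else 0 := by
      ext n
      have hn : toFock m (termState m t) n ≠ 0 → n ⟨0, hm⟩ = t.2.2.2.getD 0 0 := by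
        intro h
        by_contra hne
        refine h ?_
        rw [toFock_apply, termState, scaledKet, Finsupp.smul_apply, Finsupp.single_eq_of_ne,
          smul_zero]
        rintro rfl
        exact hne rfl
      rw [restriction_apply]
      by_cases h : toFock m (termState m t) n = 0
      · rw [Set.indicator_apply_eq_zero.2 fun _ => h]
        split_ifs
        · exact h.symm
        · rfl
      · have hiff : n ∈ {n : Fin m → ℕ | n ⟨0, hm⟩ ∈ Set.Icc a b} ↔
            a ≤ t.2.2.2.getD 0 0 ∧ t.2.2.2.getD 0 0 ≤ b := by rw [← hn h]; rfl
        split_ifs with hab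
        · exact Set.indicator_of_mem (hiff.2 hab) _
        · exact Set.indicator_of_notMem (hab ∘ hiff.1) _
    rw [codeState_cons, map_add, map_add, ih, ht, restrictCode, restrictCode, List.filter_cons]
    simp only [decide_eq_true_eq]
    split_ifs
    · rw [codeState_cons, map_add]
    · rw [zero_add]

theorem halfLT_iff (c : StateCode) : HalfLT m c ↔ 1 / 2 < ‖toFock m (codeState m c)‖ ^ 2 := by
  have h := norm_sq_codeState m c
  have hD : (0 : ℝ) < 4 ^ denominator c := by positivity
  have h1 : HalfLT m c ↔ (2 * gram m 2 c + 4 ^ denominator c : ℝ) < 2 * gram m 0 c := by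
    rw [HalfLT]
    exact_mod_cast Iff.rfl
  rw [h1, ← mul_lt_mul_iff_left₀ hD (b := 1 / 2), h]
  constructor <;> intro h' <;> linarith

end Measurement

theorem norm_finalState {k m : ℕ} (U : Unitaries k m) (gs : List (Gate k m)) (φ : Fock m) :
    ‖finalState U gs φ‖ = ‖φ‖ := by
  induction gs generalizing φ with
  | nil => rfl
  | cons g gs ih => rw [finalState, ih, LinearIsometryEquiv.norm_map]

theorem Circuit.prob_eq {k : ℕ} (C : Circuit k) (U : Unitaries k C.modes) (S : Set ℕ) :
    C.prob U S = ‖restriction {n | n ⟨0, C.modes_pos⟩ ∈ S} (C.output U)‖ ^ 2 :=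
  (norm_restriction_sq _ _).symm

/-- A number larger than the indices of all gates that are described by `w`. -/
def indexBound (w : List Token) : ℕ :=
  ((readTable w).tail.map fun row => ((row.map readSigned).getD 1 (0, 0)).2 + 1).sum

theorem lt_indexBound {w : List Token} {row : List (List Bool)} (h : row ∈ (readTable w).tail) :
    ((row.map readSigned).getD 1 (0, 0)).2 < indexBound w :=
  List.le_sum_of_mem (List.mem_map_of_mem
    (f := fun row : List (List Bool) => ((row.map readSigned).getD 1 (0, 0)).2 + 1) h)

section Verify

variable {𝒢 : GateSet} {F : ℕ → ℕ → List (List ℕ × ℤ × ℤ)} {C : Circuit 𝒢.modes} {a b : ℕ}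

theorem Circuit.IsDescribedBy.readTable_eq {r : ℕ} {w : List Token} (h : C.IsDescribedBy a b r w) :
    (readSigned (((readTable w).getD 0 []).getD 0 [])).2 = C.modes ∧
    (readSigned (((readTable w).getD 0 []).getD 1 [])).2 = a ∧
    (readSigned (((readTable w).getD 0 []).getD 2 [])).2 = b ∧
    List.Forall₂ (fun g row => g.IsDescribedBy r row) C.gates (readTable w).tail := by
  obtain ⟨head, rows, hw, hhead, hrows⟩ := h
  have hget (j : ℕ) : (readSigned (head.getD j [])).2 =
      ([(C.modes : ℤ), (a : ℤ), (b : ℤ)].getD j 0).natAbs := by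
    rw [readSigned_snd, ← hhead, ← List.getD_map (f := readInt)]
    rfl
  rw [hw]
  refine ⟨?_, ?_, ?_, hrows⟩
  all_goals
    rw [List.getD_cons_zero, hget]
    simp

variable {U : Unitaries 𝒢.modes C.modes}

/-- A certificate that passes all tests determines the output of the circuit up to an error
`1/16`. -/
theorem norm_output_sub_le (hF : ∀ i r, ApproximatesPolynomial r (F i r) (𝒢.ham i))
    (hU : C.IsImplementedBy U) {r : ℕ} {w : List Token} (hw : C.IsDescribedBy a b r w)
    {L : List (List StateCode)}
    (h : (verify 𝒢.modes w (gateTable F r (indexBound w)) r L).1 = true) :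
    ‖C.output U - toFock C.modes (codeState C.modes
      (verify 𝒢.modes w (gateTable F r (indexBound w)) r L).2)‖ ≤ 1 / 16 := by
  obtain ⟨hm, -, -, hrows⟩ := hw.readTable_eq
  rw [verify, hm] at h ⊢
  have := (circuitTest_sound hF hU hrows (fun row => lt_indexBound) _ _ (vacuum C.modes) h).2
  rw [toFock_vacuumCode, sub_self, norm_zero, zero_add, ← hrows.length_eq] at this
  rw [Circuit.output]
  rw [← hrows.length_eq]
  refine this.trans ?_
  -- each of the `l` gates contributes an error `2 / 2 ^ (l + 5)`, where `l ≤ 2 ^ l`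
  have hlt : (C.gates.length : ℝ) ≤ 2 ^ C.gates.length := by
    exact_mod_cast Nat.lt_two_pow_self.le
  rw [pow_add, mul_div_assoc', div_le_div_iff₀ (by positivity) (by norm_num)]
  linarith

/-- There is a certificate that passes all tests, for every circuit. -/
theorem exists_verify (hF : ∀ i r, ApproximatesPolynomial r (F i r) (𝒢.ham i))
    (hU : C.IsImplementedBy U) {w : ℕ → List Token} (hw : ∀ r, C.IsDescribedBy a b r (w r)) :
    ∃ r L, (verify 𝒢.modes (w r) (gateTable F r (indexBound (w r))) r L).1 = true := by
  obtain ⟨L, hL⟩ := circuitTest_complete hF hU (C.gates.length + 5) vacuumCode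
  obtain ⟨r, hr⟩ := hL.exists
  obtain ⟨hm, -, -, hrows⟩ := (hw r).readTable_eq
  refine ⟨r, L, ?_⟩
  rw [verify, hm, ← hrows.length_eq]
  exact hr _ _ hrows fun row => lt_indexBound

/-- If a certificate passes all tests, then its final state decides correctly. -/
theorem decision_of_two_thirds_le (hF : ∀ i r, ApproximatesPolynomial r (F i r) (𝒢.ham i))
    (hU : C.IsImplementedBy U) {r : ℕ} {w : List Token} (hw : C.IsDescribedBy a b r w)
    {L : List (List StateCode)}
    (h : (verify 𝒢.modes w (gateTable F r (indexBound w)) r L).1 = true) :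
    (2 / 3 ≤ C.prob U (Set.Icc a b) →
      decision w (verify 𝒢.modes w (gateTable F r (indexBound w)) r L).2 = true) ∧
    (0 < a → 2 / 3 ≤ C.prob U (Set.Iic (a - 1)) →
      decision w (verify 𝒢.modes w (gateTable F r (indexBound w)) r L).2 = false) := by
  have herr := norm_output_sub_le hF hU hw h
  obtain ⟨hm, ha, hb, -⟩ := hw.readTable_eq
  set c := (verify 𝒢.modes w (gateTable F r (indexBound w)) r L).2
  set P := restriction {n : Fin C.modes → ℕ | n ⟨0, C.modes_pos⟩ ∈ Set.Icc a b}
  have hP : ‖P (C.output U) - P (toFock C.modes (codeState C.modes c))‖ ≤ 1 / 16 := by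
    rw [← map_sub]
    exact (norm_restriction_le _ _).trans herr
  have h1 := norm_sub_norm_le (P (C.output U)) (P (toFock C.modes (codeState C.modes c)))
  have h2 := norm_sub_norm_le (P (toFock C.modes (codeState C.modes c))) (P (C.output U))
  rw [norm_sub_rev] at h2
  have hn := norm_nonneg (P (C.output U))
  have hn' := norm_nonneg (P (toFock C.modes (codeState C.modes c)))
  rw [decision, hm, ha, hb, decide_eq_true_eq, decide_eq_false_iff_not, halfLT_iff,
    ← restriction_codeState C.modes_pos, Circuit.prob_eq, Circuit.prob_eq]
  refine ⟨fun hyes => ?_, fun ha hno => ?_⟩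
  -- `(4/5)² < 2/3` and `1/2 < (4/5 - 1/16)²`
  · have h3 : 4 / 5 ≤ ‖P (C.output U)‖ := by
      by_contra! hlt
      nlinarith
    nlinarith
  · have hdisj : Disjoint {n : Fin C.modes → ℕ | n ⟨0, C.modes_pos⟩ ∈ Set.Icc a b}
        {n : Fin C.modes → ℕ | n ⟨0, C.modes_pos⟩ ∈ Set.Iic (a - 1)} := by
      rw [Set.disjoint_left]
      intro n hn hn'
      simp only [Set.mem_ofPred_eq, Set.mem_Icc, Set.mem_Iic] at hn hn'
      omega
    have h4 := norm_restriction_sq_add_le hdisj (C.output U)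
    have hout : ‖C.output U‖ = 1 := by rw [Circuit.output, norm_finalState, vacuum, norm_ket]
    rw [hout] at h4
    -- `1/3 < (3/5)²` and `(3/5 + 1/16)² < 1/2`
    have h3 : ‖P (C.output U)‖ ≤ 3 / 5 := by
      by_contra! hlt
      nlinarith
    rw [not_lt]
    nlinarith

end Verify

/-! ### The search for a certificate -/

section Computable

variable {α β σ : Type*} [Primcodable α] [Primcodable β] [Primcodable σ]

theorem _root_.Computable.map_range {f : α → ℕ} {g : α → ℕ → σ} (hf : Computable f)
    (hg : Computable₂ g) : Computable fun a => (List.range (f a)).map (g a) := by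
  have h : Computable₂ fun (a : α) (p : ℕ × List σ) => p.2 ++ [g a p.1] :=
    Primrec.list_append.to_comp.comp (Computable.snd.comp Computable.snd)
      (Computable.list_cons.comp (hg.comp Computable.fst (Computable.fst.comp Computable.snd))
        (Computable.const []))
  refine (Computable.nat_rec hf (Computable.const []) h).of_eq fun a => ?_
  induction f a with
  | zero => rfl
  | succ n ih => rw [List.range_succ, List.map_append, ← ih]; rfl

theorem _root_.Primrec.computable_comp₄ {β₁ β₂ β₃ β₄ : Type*} [Primcodable β₁] [Primcodable β₂]
    [Primcodable β₃] [Primcodable β₄] {v : β₁ → β₂ → β₃ → β₄ → σ}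
    (hv : Primrec fun q : β₁ × β₂ × β₃ × β₄ => v q.1 q.2.1 q.2.2.1 q.2.2.2)
    {f₁ : α → β₁} {f₂ : α → β₂} {f₃ : α → β₃} {f₄ : α → β₄} (h₁ : Computable f₁)
    (h₂ : Computable f₂) (h₃ : Computable f₃) (h₄ : Computable f₄) :
    Computable fun a => v (f₁ a) (f₂ a) (f₃ a) (f₄ a) :=
  hv.to_comp.comp (h₁.pair (h₂.pair (h₃.pair h₄)))

/-- Unbounded search: if for each `a` the partial computable function `V a` is defined somewhere,
then one of its values is a computable function of `a`. -/
theorem _root_.Computable₂.exists_mem {V : α → β → Option σ} (hV : Computable₂ V)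
    (h : ∀ a, ∃ b, (V a b).isSome) :
    ∃ g : α → σ, Computable g ∧ ∀ a, ∃ b, V a b = some (g a) := by
  have hf : Computable₂ fun (a : α) (n : ℕ) => (Encodable.decode (α := β) n).bind (V a) :=
    Computable.option_bind (Computable.decode.comp Computable.snd)
      (hV.comp (Computable.fst.comp Computable.fst) Computable.snd)
  have hdom (a : α) : (Nat.rfindOpt fun n => (Encodable.decode (α := β) n).bind (V a)).Dom := by
    obtain ⟨b, hb⟩ := h a
    obtain ⟨s, hs⟩ := Option.isSome_iff_exists.1 hb
    exact Nat.rfindOpt_dom.2 ⟨Encodable.encode b, s, by simpa using hs⟩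
  refine ⟨fun a => (Nat.rfindOpt fun n => (Encodable.decode (α := β) n).bind (V a)).get (hdom a),
    (Partrec.rfindOpt hf).of_eq_tot fun a => Part.get_mem _, fun a => ?_⟩
  obtain ⟨n, hn⟩ := Nat.rfindOpt_spec (Part.get_mem (hdom a))
  obtain ⟨b, -, hb⟩ := Option.bind_eq_some_iff.1 hn
  exact ⟨b, hb⟩

end Computable

theorem primrec_inputString : Primrec inputString := by
  have h : Primrec fun p : List Bool × ℕ =>
      p.1.map some ++ (List.range p.2).map fun _ => (none : Option Bool) := by
    have hs : Primrec fun p : (List Bool × ℕ) × Bool => some p.2 := Primrec.option_some.comp .snd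
    fun_prop
  exact h.of_eq fun p => by simp [inputString]

theorem primrec_signedCoefficients : Primrec signedCoefficients := by
  have h1 := Primrec.int_sign_natAbs
  have hre : Primrec fun p : List (List ℕ × ℤ × ℤ) × (List ℕ × ℤ × ℤ) =>
      ((if p.2.2.1 < 0 then 2 else 0 : ℕ), p.2.2.1.natAbs) := h1.comp (by fun_prop)
  have him : Primrec fun p : List (List ℕ × ℤ × ℤ) × (List ℕ × ℤ × ℤ) =>
      ((if p.2.2.2 < 0 then 2 else 0 : ℕ), p.2.2.2.natAbs) := h1.comp (by fun_prop)
  exact Primrec.fun_map (by fun_prop) (by fun_prop)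

theorem computable_gateTable {F : ℕ → ℕ → List (List ℕ × ℤ × ℤ)} (hF : Computable₂ F) :
    Computable₂ (gateTable F) := by
  have hs := primrec_signedCoefficients.to_comp
  refine Computable.map_range Computable.snd (Computable.pair (hs.comp (hF.comp Computable.snd
    (Computable.const 0))) (hs.comp (hF.comp Computable.snd (Computable.fst.comp Computable.fst))))

theorem primrec_indexBound : Primrec indexBound := by
  have := primrec_readTable
  unfold indexBound
  fun_prop

/-- The decision procedure: search for a precision and polygons that pass all tests, and look at the
final state of the polygons. -/
theorem Solves.exists_computable {𝒢 : GateSet} {A : PromiseProblem}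
    {C : List Bool → Circuit 𝒢.modes} {U : ∀ x, Unitaries 𝒢.modes (C x).modes}
    {a b : List Bool → ℕ} (h : Solves 𝒢 A C U a b) :
    ∃ D : List Bool → Bool, Computable D ∧ (∀ x ∈ A.yes, D x = true) ∧
      ∀ x ∈ A.no, D x = false := by
  obtain ⟨F, hFc, hF⟩ := 𝒢.computable
  obtain ⟨f, ⟨tm⟩, hf⟩ := h.uniform
  have hfp : Primrec f := tm.primrec primrec_inputString
  let verdict (x : List Bool) (y : ℕ × List (List StateCode)) : Bool × StateCode :=
    verify 𝒢.modes (f (x, y.1)) (gateTable F y.1 (indexBound (f (x, y.1)))) y.1 y.2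
  have hfx : Computable fun p : List Bool × ℕ × List (List StateCode) => f (p.1, p.2.1) :=
    Primrec.to_comp (hfp.comp (by fun_prop))
  have hr : Computable fun p : List Bool × ℕ × List (List StateCode) => p.2.1 :=
    Computable.fst.comp Computable.snd
  have hverdict : Computable fun p : List Bool × ℕ × List (List StateCode) => verdict p.1 p.2 :=
    Primrec.computable_comp₄ (v := verify 𝒢.modes) (by fun_prop) hfx
      ((computable_gateTable hFc).comp hr (primrec_indexBound.to_comp.comp hfx)) hr
      (Computable.snd.comp Computable.snd)
  have hdec : Primrec₂ decision := by
    unfold Primrec₂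
    fun_prop
  have hV : Computable₂ fun (x : List Bool) (y : ℕ × List (List StateCode)) =>
      bif (verdict x y).1 then some (decision (f (x, y.1)) (verdict x y).2) else none :=
    Computable.cond (Computable.fst.comp hverdict)
      (Computable.option_some.comp (hdec.to_comp.comp hfx (Computable.snd.comp hverdict)))
      (Computable.const none)
  obtain ⟨D, hD, hDV⟩ := hV.exists_mem fun x => by
    obtain ⟨r, L, hrL⟩ := exists_verify hF (h.implemented x) (hf x)
    refine ⟨(r, L), ?_⟩
    have : (verdict x (r, L)).1 = true := hrL
    simp [this]
  have key (x : List Bool) : ∃ y, (verdict x y).1 = true ∧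
      D x = decision (f (x, y.1)) (verdict x y).2 := by
    obtain ⟨y, hy⟩ := hDV x
    refine ⟨y, ?_⟩
    cases hv : (verdict x y).1 <;> simp_all
  refine ⟨D, hD, fun x hx => ?_, fun x hx => ?_⟩
  · obtain ⟨y, hy, hDx⟩ := key x
    rw [hDx]
    exact (decision_of_two_thirds_le hF (h.implemented x) (hf x y.1) hy).1 (h.complete x hx)
  · obtain ⟨y, hy, hDx⟩ := key x
    rw [hDx]
    exact (decision_of_two_thirds_le hF (h.implemented x) (hf x y.1) hy).2 (h.pos x) (h.sound x hx)

theorem mem_promiseR {𝒢 : GateSet} {A : PromiseProblem} (h : A ∈ CVBQP 𝒢) : A ∈ PromiseR := by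
  obtain ⟨C, U, a, b, h⟩ := h
  obtain ⟨D, hD, hyes, hno⟩ := h.exists_computable
  refine ⟨{x | D x = true}, ⟨fun x => by infer_instance, ?_⟩, hyes, ?_⟩
  · simpa using hD
  · rw [Set.disjoint_left]
    intro x hx hx'
    simp [hno x hx] at hx'

end Bosonic

end

theorem mainTheorem6 (𝒢 : Bosonic.GateSet) :
    Bosonic.CVBQPphys 𝒢 ⊆ Bosonic.PromiseR ∧
      ∀ L : Set (List Bool),
        Bosonic.PromiseProblem.ofLanguage L ∈ Bosonic.CVBQPphys 𝒢 → L ∈ Bosonic.R := by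
  have key : Bosonic.CVBQPphys 𝒢 ⊆ Bosonic.PromiseR := by
    rintro A ⟨C, U, a, b, h, -⟩
    exact Bosonic.mem_promiseR ⟨C, U, a, b, h⟩
  refine ⟨key, fun L hL => ?_⟩
  obtain ⟨L', hL', hyes, hno⟩ := key hL
  have : L = L' := hyes.antisymm (Set.disjoint_compl_left_iff_subset.1 hno)
  rwa [this]
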